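/- Fix $d,\gamma,h>0$ and let $x=(\tilde p,\tilde v,a_d,\eta)\in\mathbb R^4$. Let $x^+=A_dx+B_du$, $u\in\mathbb R$, be the exact zero-order-hold discretization with sampling period $h$ of $$\dot{\tilde p}=\tilde v,\quad \dot{\tilde v}=-d\tilde v+a_d,\quad \dot a_d=-\tfrac1\gamma(a_d-\eta),\quad \dot\eta=-\tfrac1\gamma(\eta-u).$$ Let $\Delta:[0,\infty)\to(0,\infty)$ and, for $i,k\in\mathbb N_0$, put $\Delta_{i|k}=\inf\{\Delta(t): t\in[(k+i)h,(k+i+1)h]\}$ and $\Delta(k)=\Delta_{0|k}$. Put $\alpha=e^{-h/\gamma}$, $\beta=\frac h\gamma e^{-h/\gamma}$, and assume $$\Delta(k+1)>e^{-h/\gamma}\left(1+\tfrac h\gamma\right)\Delta(k)\qquad\text{for all }k\in\mathbb N_0 .$$ Let $N\ge1$, let $Q\in\mathbb R^{4\times4}$ be symmetric positive definite and $R>0$. Let $M_c\succ0$ satisfy $A_d^{\mathsf T}M_cA_d-M_c\preceq0$, let $\kappa>0$ satisfy $\kappa B_d^{\mathsf T}M_cB_d<1$, put $K=-\kappa B_d^{\mathsf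 T}M_cA_d$, and let $M_q\succ0$ satisfy $(A_d+B_dK)^{\mathsf T}M_q(A_d+B_dK)-M_q=-I$. Let $$\Delta^*=\min\Big\{\tfrac{\inf_k[\Delta(k+1)-(\alpha+\beta)\Delta(k)]}{1-\alpha-\beta},\ \tfrac{\inf_k[\Delta(k+1)-\alpha\Delta(k)]}{1-\alpha},\ \inf_k\Delta(k)\Big\},$$ let $L_u$ satisfy $\Delta^*L_u>1$, and let $$\lambda=\frac{2\kappa L_u\,\sigma_{\max}(A_d^{\mathsf T}M_qB_d)}{\sqrt{\lambda_{\min}(M_c)}},\qquad \Theta>0,\quad \Theta\ge\lambda_{\max}\big(Q+\kappa^2A_d^{\mathsf T}M_cB_dRB_d^{\mathsf T}M_cA_d\big).$$ At time $k$ and state $x$ consider the problem of minimizing $$\Theta\big[x_{N|k}^{\mathsf T}M_qx_{N|k}+\lambda(x_{N|k}^{\mathsf T}M_cx_{N|k})^{3/2}\big]+\sum_{i=0}^{N-1}\big(x_{i|k}^{\mathsf T}Qx_{i|k}+R\,u_{i|k}^2\big)$$ over $(u_{0|k},\dots,u_{N-1|k})$ subject to $x_{0|k}=x$, $x_{i+1|k}=A_dx_{i|k}+B_du_{i|k}$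 and $u_{\min,i|k}\le u_{i|k}\le u_{\max,i|k}$ for $0\le i<N$. Here, with $a_{i|k},\eta_{i|k}$ the third and fourth coordinates of $x_{i|k}$, $$u_{\max,i|k}=\min\Big\{\Delta_{i|k},\ \tfrac{\Delta_{i+1|k}-\alpha a_{i|k}-\beta\eta_{i|k}}{1-\alpha-\beta},\ \tfrac{\Delta_{i+1|k}-\alpha\eta_{i|k}}{1-\alpha}\Big\},$$ $$u_{\min,i|k}=\max\Big\{-\Delta_{i|k},\ \tfrac{-\Delta_{i+1|k}-\alpha a_{i|k}-\beta\eta_{i|k}}{1-\alpha-\beta},\ \tfrac{-\Delta_{i+1|k}-\alpha\eta_{i|k}}{1-\alpha}\Big\}.$$ Let $\mathcal F_k\subseteq\mathbb R^4$ be the set of states for which this problem is feasible at time $k$. Then: 1. every $x$ with $|a_d|\le\Delta(k)$ and $|\eta|\le\Delta(k)$ (with $\tilde p,\tilde v$ arbitrary) belongs to $\mathcal F_k$; 2. for all $k$ and $x\in\mathcal F_k$ the minimum is attained, so an MPC law $k_N(k,x)$, the first input of an optimal sequence, exists; 3. for every such law, the closed loop $x(k+1)=A_dx(k)+B_dk_N(k,x(k))$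 is uniformly globally asymptotically stable on $(\mathcal F_k)_{k\ge0}$. That is, $0\in\mathcal F_k$ for all $k$; $x(k)\in\mathcal F_k$ implies $x(k+1)\in\mathcal F_{k+1}$; there is $\delta:\mathbb R\to\mathbb R$, positive on $(0,\infty)$ and with $\delta(\varepsilon)\to\infty$ as $\varepsilon\to\infty$, such that for every $\varepsilon>0$ and every solution starting at a time $k_0\ge 0$ in $\mathcal F_{k_0}$, $\|x(k_0)\|<\delta(\varepsilon)$ implies $\|x(k)\|<\varepsilon$ for all $k\ge k_0$; and for all $\rho,c>0$ there is $T\in\mathbb N_0$ such that for every such solution $\|x(k_0)\|<c$ implies $\|x(k)\|<\rho$ for all $k\ge k_0+T$. -/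

import Mathlib

open scoped Matrix

noncomputable section

namespace AxisMPC

/-- Single-axis states, in the order: position error, velocity error, desired acceleration `a_d`
(coordinate 2), and filter state `η` (coordinate 3). -/
abbrev State : Type := Fin 4 → ℝ

/-! ### The single-axis model and its exact zero-order-hold discretization -/

/-- State matrix of `p' = v`, `v' = -d v + a_d`, `a_d' = -(a_d - η)/γ`, `η' = -(η - s)/γ`. -/
def Acont (d γ : ℝ) : Matrix (Fin 4) (Fin 4) ℝ :=
  !![0, 1, 0, 0;
     0, -d, 1, 0;
     0, 0, -(1 / γ), 1 / γ;
     0, 0, 0, -(1 / γ)]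

/-- Input matrix of the same continuous-time model, with scalar input `s`. -/
def Bcont (γ : ℝ) : Matrix (Fin 4) (Fin 1) ℝ :=
  !![0; 0; 0; 1 / γ]

/-- `A_d = exp (h A)`. -/
def Ad (d γ h : ℝ) : Matrix (Fin 4) (Fin 4) ℝ :=
  NormedSpace.exp (h • Acont d γ)

/-- `B_d = (∫₀ʰ exp (s A) ds) B`, entrywise. -/
def Bd (d γ h : ℝ) : Matrix (Fin 4) (Fin 1) ℝ :=
  Matrix.of fun i j => ∫ s in (0 : ℝ)..h, (NormedSpace.exp (s • Acont d γ) * Bcont γ) i j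

/-- One step `x⁺ = A x + B u` with scalar input `u`. -/
def step (A : Matrix (Fin 4) (Fin 4) ℝ) (B : Matrix (Fin 4) (Fin 1) ℝ) (x : State) (u : ℝ) :
    State :=
  A *ᵥ x + B *ᵥ (fun _ => u)

/-! ### Extreme eigenvalues and singular values -/

/-- Largest eigenvalue of a (symmetric) real matrix. -/
def lamMax {n : Type*} [Fintype n] [DecidableEq n] (M : Matrix n n ℝ) : ℝ :=
  sSup (spectrum ℝ M)

/-- Smallest eigenvalue of a (symmetric) real matrix. -/
def lamMin {n : Type*} [Fintype n] [DecidableEq n] (M : Matrix n n ℝ) : ℝ :=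
  sInf (spectrum ℝ M)

/-- Largest singular value of a real matrix. -/
def sigmaMax {m n : Type*} [Fintype m] [Fintype n] [DecidableEq n] (M : Matrix m n ℝ) : ℝ :=
  Real.sqrt (lamMax (Mᵀ * M))

/-- Euclidean norm of a state. -/
def eucl (x : State) : ℝ :=
  Real.sqrt (x ⬝ᵥ x)

/-- Quadratic form `xᵀ M x`. -/
def quad (M : Matrix (Fin 4) (Fin 4) ℝ) (x : State) : ℝ :=
  x ⬝ᵥ (M *ᵥ x)

/-! ### Time-varying bounds -/

/-- `Δ_{i|k}`, the infimum of `Δ(t)` over `t ∈ [(k+i) h, (k+i+1) h]` (a minimum if `Δ` is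
continuous). -/
def boundAt (Δ : ℝ → ℝ) (h : ℝ) (i k : ℕ) : ℝ :=
  sInf (Δ '' Set.Icc (((k : ℝ) + i) * h) (((k : ℝ) + i + 1) * h))

/-- `α = exp (-h/γ)`. -/
def alpha (h γ : ℝ) : ℝ :=
  Real.exp (-(h / γ))

/-- `β = (h/γ) exp (-h/γ)`. -/
def beta (h γ : ℝ) : ℝ :=
  h / γ * Real.exp (-(h / γ))

/-- The lower input bound at prediction step `i` of sampling instant `k`, where `x` is the
predicted state at that step. -/
def uMin (Δ : ℝ → ℝ) (h γ : ℝ) (i k : ℕ) (x : State) : ℝ :=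
  max (-boundAt Δ h i k)
    (max
      ((1 - alpha h γ - beta h γ)⁻¹ *
        (-boundAt Δ h (i + 1) k - (alpha h γ * x 2 + beta h γ * x 3)))
      (-((1 - alpha h γ)⁻¹ * (boundAt Δ h (i + 1) k + alpha h γ * x 3))))

/-- The upper input bound at prediction step `i` of sampling instant `k`, where `x` is the
predicted state at that step. -/
def uMax (Δ : ℝ → ℝ) (h γ : ℝ) (i k : ℕ) (x : State) : ℝ :=
  min (boundAt Δ h i k)
    (min
      ((1 - alpha h γ - beta h γ)⁻¹ *
        (boundAt Δ h (i + 1) k - (alpha h γ * x 2 + beta h γ * x 3)))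
      ((1 - alpha h γ)⁻¹ * (boundAt Δ h (i + 1) k - alpha h γ * x 3)))

/-- The constant `Δ*`, with `Δ(k) = Δ_{0|k}`. -/
def deltaStar (Δ : ℝ → ℝ) (h γ : ℝ) : ℝ :=
  min
    ((1 - alpha h γ - beta h γ)⁻¹ *
      ⨅ k : ℕ, (boundAt Δ h 0 (k + 1) - (alpha h γ + beta h γ) * boundAt Δ h 0 k))
    (min
      ((1 - alpha h γ)⁻¹ * ⨅ k : ℕ, (boundAt Δ h 0 (k + 1) - alpha h γ * boundAt Δ h 0 k))
      (⨅ k : ℕ, boundAt Δ h 0 k))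

/-! ### The finite-horizon optimization problem -/

/-- The predicted states `x_{i|k}` (meaningful for `i ≤ N`) from `x_{0|k} = x` under the input
sequence `U = (u_{0|k}, …, u_{N-1|k})`. -/
def pred (A : Matrix (Fin 4) (Fin 4) ℝ) (B : Matrix (Fin 4) (Fin 1) ℝ) {N : ℕ}
    (x : State) (U : Fin N → ℝ) : ℕ → State
  | 0 => x
  | i + 1 => step A B (pred A B x U i) (if hi : i < N then U ⟨i, hi⟩ else 0)

/-- The input sequence `U` satisfies all input constraints at sampling instant `k` from `x`. -/
def Feasible (Δ : ℝ → ℝ) (d γ h : ℝ) {N : ℕ} (k : ℕ) (x : State) (U : Fin N → ℝ) : Prop :=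
  ∀ i : Fin N,
    uMin Δ h γ i k (pred (Ad d γ h) (Bd d γ h) x U i) ≤ U i ∧
      U i ≤ uMax Δ h γ i k (pred (Ad d γ h) (Bd d γ h) x U i)

/-- The states from which the optimization problem at sampling instant `k` is feasible. -/
def feasibleStates (Δ : ℝ → ℝ) (d γ h : ℝ) (N k : ℕ) : Set State :=
  {x | ∃ U : Fin N → ℝ, Feasible Δ d γ h k x U}

/-- Terminal cost `V(x) = Θ [xᵀ M_q x + lam (xᵀ M_c x)^{3/2}]`. -/
def termCost (Mc Mq : Matrix (Fin 4) (Fin 4) ℝ) (lam Θ : ℝ) (x : State) : ℝ :=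
  Θ * (quad Mq x + lam * (quad Mc x) ^ (3 / 2 : ℝ))

/-- Total cost `V(x_{N|k}) + ∑_{i<N} (x_{i|k}ᵀ Q x_{i|k} + R u_{i|k}²)`. -/
def cost (A : Matrix (Fin 4) (Fin 4) ℝ) (B : Matrix (Fin 4) (Fin 1) ℝ)
    (Q : Matrix (Fin 4) (Fin 4) ℝ) (R : ℝ) (V : State → ℝ) {N : ℕ}
    (x : State) (U : Fin N → ℝ) : ℝ :=
  V (pred A B x U N) + ∑ i : Fin N, (quad Q (pred A B x U i) + U i * R * U i)

/-- `U` is an optimal input sequence at sampling instant `k` from `x`. -/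
def IsOptimal (Δ : ℝ → ℝ) (d γ h : ℝ) (Q : Matrix (Fin 4) (Fin 4) ℝ) (R : ℝ) (V : State → ℝ)
    {N : ℕ} (k : ℕ) (x : State) (U : Fin N → ℝ) : Prop :=
  Feasible Δ d γ h k x U ∧
    ∀ U' : Fin N → ℝ, Feasible Δ d γ h k x U' →
      cost (Ad d γ h) (Bd d γ h) Q R V x U ≤ cost (Ad d γ h) (Bd d γ h) Q R V x U'

/-- `kN` is an MPC law: wherever the problem is feasible, `kN k x` is the first input of an
optimal input sequence at sampling instant `k` from `x`. -/
def IsMPCLaw (Δ : ℝ → ℝ) (d γ h : ℝ) (Q : Matrix (Fin 4) (Fin 4) ℝ) (R : ℝ) (V : State → ℝ)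
    (N : ℕ) (hN : 0 < N) (kN : ℕ → State → ℝ) : Prop :=
  ∀ k : ℕ, ∀ x ∈ feasibleStates Δ d γ h N k,
    ∃ U : Fin N → ℝ, IsOptimal Δ d γ h Q R V k x U ∧ kN k x = U ⟨0, hN⟩

/-! ### Uniform global asymptotic stability -/

/-- `x` solves `x(k+1) = f(k, x(k))` from time `k₀` on. -/
def IsSolution (f : ℕ → State → State) (k₀ : ℕ) (x : ℕ → State) : Prop :=
  ∀ k, k₀ ≤ k → x (k + 1) = f k (x k)

/-- The origin of the time-varying system `x(k+1) = f(k, x(k))`, whose state space at time `k` is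
`D k`, is uniformly globally asymptotically stable: `D` is forward invariant, the origin is
uniformly stable with a modulus `δ(ε)` tending to infinity with `ε`, and solutions converge to the
origin uniformly in the initial time and in bounded sets of initial states. -/
def UGAS (D : ℕ → Set State) (f : ℕ → State → State) : Prop :=
  (∀ k, (0 : State) ∈ D k) ∧
  (∀ k, ∀ x ∈ D k, f k x ∈ D (k + 1)) ∧
  (∃ δ : ℝ → ℝ, (∀ ε, 0 < ε → 0 < δ ε) ∧ Filter.Tendsto δ Filter.atTop Filter.atTop ∧
    ∀ ε, 0 < ε → ∀ (k₀ : ℕ) (x : ℕ → State), x k₀ ∈ D k₀ → IsSolution f k₀ x →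
      eucl (x k₀) < δ ε → ∀ k, k₀ ≤ k → eucl (x k) < ε) ∧
  (∀ η c : ℝ, 0 < η → 0 < c → ∃ T : ℕ,
    ∀ (k₀ : ℕ) (x : ℕ → State), x k₀ ∈ D k₀ → IsSolution f k₀ x →
      eucl (x k₀) < c → ∀ k, k₀ + T ≤ k → eucl (x k) < η)

end AxisMPC

end

/-
The terminal cost decreases along a saturation of the linear feedback `K x`. Scaling `K x` by some
`θ ∈ [0, 1]` down to size at most `Δ*` keeps the decrease of the `M_q` part up to a defect which is
quadratic in `x`. The cubic part pays for this defect: `K x` is a negative multiple of the gradient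
`B_dᵀ M_c A_d x`, so `xᵀ M_c x` falls by at least `θ |K x|² / κ`. Inputs of size at most `Δ*` are
admissible wherever `|a_d|, |η| ≤ Δ(k)`, and every admissible input leads into this set at time
`k + 1`. Hence an optimal plan can be shifted and extended by a saturated feedback input, which
makes the optimal value a Lyapunov function. It is bounded above by a class `𝒦∞` function of `‖x‖`
since an admissible input of size `O(‖x‖)` exists wherever the problem is feasible.
-/

noncomputable section

namespace AxisMPC

section Spectral

variable {m n : Type*} [Fintype m] [Fintype n]

lemma dotProduct_self_nonneg (x : m → ℝ) : 0 ≤ x ⬝ᵥ x :=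
  Finset.sum_nonneg fun _ _ => mul_self_nonneg _

lemma abs_dotProduct_le (x y : m → ℝ) : |x ⬝ᵥ y| ≤ √(x ⬝ᵥ x) * √(y ⬝ᵥ y) := by
  rw [← Real.sqrt_mul (dotProduct_self_nonneg x)]
  refine Real.abs_le_sqrt ?_
  simpa only [dotProduct, sq] using Finset.sum_mul_sq_le_sq_mul_sq Finset.univ x y

open scoped MatrixOrder in
lemma dotProduct_mulVec_mono {M M' : Matrix n n ℝ} (h : M ≤ M') (x : n → ℝ) :
    x ⬝ᵥ (M *ᵥ x) ≤ x ⬝ᵥ (M' *ᵥ x) := by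
  have := (Matrix.le_iff.1 h).dotProduct_mulVec_nonneg x
  simpa only [star_trivial, Matrix.sub_mulVec, dotProduct_sub, sub_nonneg] using this

variable [DecidableEq n] {M : Matrix n n ℝ}

lemma dotProduct_algebraMap_mulVec (c : ℝ) (x : n → ℝ) :
    x ⬝ᵥ (algebraMap ℝ (Matrix n n ℝ) c *ᵥ x) = c * (x ⬝ᵥ x) := by
  rw [Algebra.algebraMap_eq_smul_one, Matrix.smul_mulVec, Matrix.one_mulVec, dotProduct_smul,
    smul_eq_mul]

open scoped MatrixOrder in
lemma dotProduct_mulVec_le_lamMax (hM : M.IsHermitian) (x : n → ℝ) :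
    x ⬝ᵥ (M *ᵥ x) ≤ lamMax M * (x ⬝ᵥ x) := by
  rw [← dotProduct_algebraMap_mulVec]
  exact dotProduct_mulVec_mono ((le_algebraMap_iff_spectrum_le (ha := hM)).2
    fun _ hr => le_csSup (Matrix.finite_real_spectrum).bddAbove hr) x

open scoped MatrixOrder in
lemma lamMin_mul_le_dotProduct_mulVec (hM : M.IsHermitian) (x : n → ℝ) :
    lamMin M * (x ⬝ᵥ x) ≤ x ⬝ᵥ (M *ᵥ x) := by
  rw [← dotProduct_algebraMap_mulVec]
  exact dotProduct_mulVec_mono ((algebraMap_le_iff_le_spectrum (ha := hM)).2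
    fun _ hr => csInf_le (Matrix.finite_real_spectrum).bddBelow hr) x

lemma spectrum_nonempty [Nonempty n] (hM : M.IsHermitian) : (spectrum ℝ M).Nonempty :=
  hM.spectrum_real_eq_range_eigenvalues ▸ Set.range_nonempty _

lemma lamMin_pos [Nonempty n] (hM : M.PosDef) : 0 < lamMin M := by
  have hmem : lamMin M ∈ spectrum ℝ M :=
    (spectrum_nonempty hM.isHermitian).csInf_mem Matrix.finite_real_spectrum
  obtain ⟨i, hi⟩ := hM.isHermitian.spectrum_real_eq_range_eigenvalues ▸ hmem
  exact hi ▸ hM.eigenvalues_pos i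

lemma lamMax_pos [Nonempty n] (hM : M.PosDef) : 0 < lamMax M :=
  (lamMin_pos hM).trans_le <| csInf_le_csSup (spectrum_nonempty hM.isHermitian)
    Matrix.finite_real_spectrum.bddBelow Matrix.finite_real_spectrum.bddAbove

lemma sqrt_mulVec_le_sigmaMax (W : Matrix m n ℝ) (x : n → ℝ) :
    √((W *ᵥ x) ⬝ᵥ (W *ᵥ x)) ≤ sigmaMax W * √(x ⬝ᵥ x) := by
  have hherm : (Wᵀ * W).IsHermitian := by
    simpa only [Matrix.conjTranspose_eq_transpose_of_trivial] using
      Matrix.isHermitian_conjTranspose_mul_self W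
  rw [sigmaMax, ← Real.sqrt_mul' _ (dotProduct_self_nonneg x)]
  refine Real.sqrt_le_sqrt ?_
  calc (W *ᵥ x) ⬝ᵥ (W *ᵥ x) = x ⬝ᵥ ((Wᵀ * W) *ᵥ x) := by
        rw [← Matrix.mulVec_mulVec, Matrix.dotProduct_mulVec x, Matrix.vecMul_transpose]
    _ ≤ lamMax (Wᵀ * W) * (x ⬝ᵥ x) := dotProduct_mulVec_le_lamMax hherm x

lemma sigmaMax_nonneg (W : Matrix m n ℝ) : 0 ≤ sigmaMax W := Real.sqrt_nonneg _

lemma abs_mulVec_dotProduct_le (W : Matrix m n ℝ) (x : n → ℝ) (y : m → ℝ) :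
    |(W *ᵥ x) ⬝ᵥ y| ≤ sigmaMax W * √(x ⬝ᵥ x) * √(y ⬝ᵥ y) :=
  (abs_dotProduct_le _ _).trans
    (mul_le_mul_of_nonneg_right (sqrt_mulVec_le_sigmaMax W x) (Real.sqrt_nonneg _))

end Spectral

lemma eucl_nonneg (x : State) : 0 ≤ eucl x := Real.sqrt_nonneg _

lemma eucl_sq (x : State) : eucl x ^ 2 = x ⬝ᵥ x := Real.sq_sqrt (dotProduct_self_nonneg x)

lemma abs_apply_le_eucl (x : State) (i : Fin 4) : |x i| ≤ eucl x :=
  Real.abs_le_sqrt <| (sq (x i)).trans_le <|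
    Finset.single_le_sum (f := fun j => x j * x j) (fun _ _ => mul_self_nonneg _)
      (Finset.mem_univ i)

lemma eucl_add_le (x y : State) : eucl (x + y) ≤ eucl x + eucl y := by
  have heucl : ∀ z : State, eucl z = ‖WithLp.toLp 2 z‖ := fun z => by
    simp only [eucl, dotProduct, EuclideanSpace.norm_eq, Real.norm_eq_abs, sq_abs, ← sq]
  simpa only [heucl, WithLp.toLp_add] using norm_add_le (WithLp.toLp 2 x) (WithLp.toLp 2 y)

lemma eucl_step_le (A : Matrix (Fin 4) (Fin 4) ℝ) (B : Matrix (Fin 4) (Fin 1) ℝ) (x : State)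
    (u : ℝ) : eucl (step A B x u) ≤ sigmaMax A * eucl x + sigmaMax B * |u| := by
  have hu : √((fun _ : Fin 1 => u) ⬝ᵥ fun _ => u) = |u| := by
    rw [dotProduct, Fin.sum_univ_one, Real.sqrt_mul_self_eq_abs]
  calc eucl (step A B x u) ≤ eucl (A *ᵥ x) + eucl (B *ᵥ fun _ => u) := eucl_add_le _ _
    _ ≤ sigmaMax A * eucl x + sigmaMax B * |u| := by
        rw [← hu]
        exact add_le_add (sqrt_mulVec_le_sigmaMax A x) (sqrt_mulVec_le_sigmaMax B _)

lemma quad_nonneg {M : Matrix (Fin 4) (Fin 4) ℝ} (hM : M.PosSemidef) (x : State) :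
    0 ≤ quad M x := by
  simpa only [quad, star_trivial] using hM.dotProduct_mulVec_nonneg x

lemma quad_le_lamMax {M : Matrix (Fin 4) (Fin 4) ℝ} (hM : M.IsHermitian) (x : State) :
    quad M x ≤ lamMax M * eucl x ^ 2 :=
  eucl_sq x ▸ dotProduct_mulVec_le_lamMax hM x

lemma lamMin_le_quad {M : Matrix (Fin 4) (Fin 4) ℝ} (hM : M.IsHermitian) (x : State) :
    lamMin M * eucl x ^ 2 ≤ quad M x :=
  eucl_sq x ▸ lamMin_mul_le_dotProduct_mulVec hM x

section SaturatedFeedback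

variable {m n : Type*} [Fintype m] [Fintype n] {A M : Matrix n n ℝ} {B : Matrix n m ℝ}
  {K : Matrix m n ℝ}

lemma dotProduct_mulVec_comm (hM : M.IsHermitian) (x y : n → ℝ) :
    x ⬝ᵥ (M *ᵥ y) = y ⬝ᵥ (M *ᵥ x) := by
  rw [← Matrix.dotProduct_transpose_mulVec M x y, ← Matrix.conjTranspose_eq_transpose_of_trivial,
    hM.eq]

lemma dotProduct_transpose_mul_mul_mulVec {k l : Type*} [Fintype k] [Fintype l]
    (A : Matrix n k ℝ) (M : Matrix n l ℝ) (B : Matrix l m ℝ) (x : k → ℝ) (v : m → ℝ) :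
    x ⬝ᵥ ((Aᵀ * M * B) *ᵥ v) = (A *ᵥ x) ⬝ᵥ (M *ᵥ (B *ᵥ v)) := by
  rw [← Matrix.mulVec_mulVec, ← Matrix.mulVec_mulVec, Matrix.dotProduct_mulVec x,
    Matrix.vecMul_transpose]

lemma dotProduct_mulVec_add_smul (hM : M.IsHermitian) (z w : n → ℝ) (c : ℝ) :
    (z + c • w) ⬝ᵥ (M *ᵥ (z + c • w)) =
      z ⬝ᵥ (M *ᵥ z) + 2 * c * (z ⬝ᵥ (M *ᵥ w)) + c ^ 2 * (w ⬝ᵥ (M *ᵥ w)) := by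
  simp only [Matrix.mulVec_add, Matrix.mulVec_smul, dotProduct_add, add_dotProduct,
    smul_dotProduct, dotProduct_smul, smul_eq_mul, dotProduct_mulVec_comm hM w z]
  ring

lemma dotProduct_mulVec_scaled_feedback_le [DecidableEq m] [DecidableEq n] (hM : M.PosSemidef)
    (hMK : (A + B * K)ᵀ * M * (A + B * K) - M = -1) {θ : ℝ} (h0 : 0 ≤ θ) (h1 : θ ≤ 1)
    (x : n → ℝ) :
    (A *ᵥ x + B *ᵥ (θ • K *ᵥ x)) ⬝ᵥ (M *ᵥ (A *ᵥ x + B *ᵥ (θ • K *ᵥ x))) ≤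
      x ⬝ᵥ (M *ᵥ x) - x ⬝ᵥ x +
        2 * sigmaMax (Aᵀ * M * B) * √(x ⬝ᵥ x) * ((1 - θ) * √((K *ᵥ x) ⬝ᵥ (K *ᵥ x))) := by
  set z := A *ᵥ x
  set w := B *ᵥ (K *ᵥ x)
  have hfull : (z + w) ⬝ᵥ (M *ᵥ (z + w)) = x ⬝ᵥ (M *ᵥ x) - x ⬝ᵥ x := by
    have hclosed : (A + B * K) *ᵥ x = z + w := by
      rw [Matrix.add_mulVec, ← Matrix.mulVec_mulVec]
    rw [← hclosed, ← dotProduct_transpose_mul_mul_mulVec, eq_add_of_sub_eq hMK,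
      Matrix.add_mulVec, Matrix.neg_mulVec, Matrix.one_mulVec, dotProduct_add, dotProduct_neg]
    ring
  have hcross : -(z ⬝ᵥ (M *ᵥ w)) ≤
      sigmaMax (Aᵀ * M * B) * √((K *ᵥ x) ⬝ᵥ (K *ᵥ x)) * √(x ⬝ᵥ x) := by
    rw [← dotProduct_transpose_mul_mul_mulVec, dotProduct_comm]
    exact (neg_le_abs _).trans (abs_mulVec_dotProduct_le _ _ _)
  have hw : 0 ≤ w ⬝ᵥ (M *ᵥ w) := hM.dotProduct_mulVec_nonneg w
  have hone := dotProduct_mulVec_add_smul hM.isHermitian z w 1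
  rw [one_smul] at hone
  rw [Matrix.mulVec_smul, dotProduct_mulVec_add_smul hM.isHermitian]
  nlinarith [mul_le_mul_of_nonneg_left hcross (sub_nonneg.2 h1), mul_nonneg hw
    (sub_nonneg.2 (pow_le_one₀ h0 h1 (n := 2)))]

lemma dotProduct_mulVec_scaled_gradient_le [DecidableEq m] (hM : M.IsHermitian)
    (hMA : (M - Aᵀ * M * A).PosSemidef) {κ : ℝ} (hκ : 0 ≤ κ)
    (hκB : (1 - κ • (Bᵀ * M * B)).PosSemidef) (hK : K = -(κ • (Bᵀ * M * A)))
    {θ : ℝ} (h0 : 0 ≤ θ) (h1 : θ ≤ 1) (x : n → ℝ) :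
    κ * ((A *ᵥ x + B *ᵥ (θ • K *ᵥ x)) ⬝ᵥ (M *ᵥ (A *ᵥ x + B *ᵥ (θ • K *ᵥ x)))) ≤
      κ * (x ⬝ᵥ (M *ᵥ x)) - θ * ((K *ᵥ x) ⬝ᵥ (K *ᵥ x)) := by
  set z := A *ᵥ x
  set v := K *ᵥ x with hv
  have hdrift : z ⬝ᵥ (M *ᵥ z) ≤ x ⬝ᵥ (M *ᵥ x) := by
    rw [← dotProduct_transpose_mul_mul_mulVec]
    have := hMA.dotProduct_mulVec_nonneg x
    simpa only [star_trivial, Matrix.sub_mulVec, dotProduct_sub, sub_nonneg] using this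
  have hcross : κ * (z ⬝ᵥ (M *ᵥ (B *ᵥ v))) = -(v ⬝ᵥ v) := by
    have hgrad : κ • ((Bᵀ * M * A) *ᵥ x) = -v := by
      rw [hv, hK, Matrix.neg_mulVec, Matrix.smul_mulVec, neg_neg]
    rw [dotProduct_mulVec_comm hM, ← dotProduct_transpose_mul_mul_mulVec, ← smul_eq_mul,
      ← dotProduct_smul, hgrad, dotProduct_neg]
  have hinput : κ * ((B *ᵥ v) ⬝ᵥ (M *ᵥ (B *ᵥ v))) ≤ v ⬝ᵥ v := by
    rw [← dotProduct_transpose_mul_mul_mulVec]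
    have := hκB.dotProduct_mulVec_nonneg v
    simpa only [star_trivial, Matrix.sub_mulVec, Matrix.one_mulVec, Matrix.smul_mulVec,
      dotProduct_sub, dotProduct_smul, smul_eq_mul, sub_nonneg] using this
  have hv0 := dotProduct_self_nonneg v
  rw [Matrix.mulVec_smul, dotProduct_mulVec_add_smul hM]
  calc κ * (z ⬝ᵥ (M *ᵥ z) + 2 * θ * (z ⬝ᵥ (M *ᵥ (B *ᵥ v))) +
        θ ^ 2 * ((B *ᵥ v) ⬝ᵥ (M *ᵥ (B *ᵥ v))))
      = κ * (z ⬝ᵥ (M *ᵥ z)) + 2 * θ * (κ * (z ⬝ᵥ (M *ᵥ (B *ᵥ v)))) +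
        θ ^ 2 * (κ * ((B *ᵥ v) ⬝ᵥ (M *ᵥ (B *ᵥ v)))) := by ring
    _ ≤ κ * (x ⬝ᵥ (M *ᵥ x)) + 2 * θ * -(v ⬝ᵥ v) + θ ^ 2 * (v ⬝ᵥ v) := by
        rw [hcross]
        gcongr
    _ ≤ κ * (x ⬝ᵥ (M *ᵥ x)) + 2 * θ * -(v ⬝ᵥ v) + θ * (v ⬝ᵥ v) := by
        gcongr
        exact pow_le_of_le_one h0 h1 two_ne_zero
    _ = κ * (x ⬝ᵥ (M *ᵥ x)) - θ * (v ⬝ᵥ v) := by ring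

lemma isHermitian_add_smul_gain {Q : Matrix n n ℝ} (hQ : Q.IsHermitian) (hM : M.IsHermitian)
    (c : ℝ) : (Q + c • (Aᵀ * M * B * Bᵀ * M * A)).IsHermitian := by
  rw [Matrix.IsHermitian, Matrix.conjTranspose_eq_transpose_of_trivial] at *
  simp only [Matrix.transpose_add, Matrix.transpose_smul, Matrix.transpose_mul,
    Matrix.transpose_transpose, hQ, hM, Matrix.mul_assoc]

lemma stage_cost_feedback_le [DecidableEq n] {Q : Matrix n n ℝ} (hQ : Q.IsHermitian)
    (hM : M.IsHermitian) {κ R : ℝ} (hK : K = -(κ • (Bᵀ * M * A))) (x : n → ℝ) :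
    x ⬝ᵥ (Q *ᵥ x) + R * ((K *ᵥ x) ⬝ᵥ (K *ᵥ x)) ≤
      lamMax (Q + (κ ^ 2 * R) • (Aᵀ * M * B * Bᵀ * M * A)) * (x ⬝ᵥ x) := by
  have hKx : (K *ᵥ x) ⬝ᵥ (K *ᵥ x) =
      κ ^ 2 * (x ⬝ᵥ ((Aᵀ * M * B * Bᵀ * M * A) *ᵥ x)) := by
    have hassoc : Aᵀ * M * B * Bᵀ * M * A = (Bᵀ * M * A)ᵀ * (Bᵀ * M * A) := by
      rw [Matrix.IsHermitian, Matrix.conjTranspose_eq_transpose_of_trivial] at hM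
      simp only [Matrix.transpose_mul, Matrix.transpose_transpose, hM, Matrix.mul_assoc]
    rw [hassoc, ← Matrix.mulVec_mulVec, Matrix.dotProduct_mulVec x, Matrix.vecMul_transpose, hK,
      Matrix.neg_mulVec, Matrix.smul_mulVec, neg_dotProduct_neg, smul_dotProduct,
      dotProduct_smul, smul_eq_mul, smul_eq_mul]
    ring
  calc x ⬝ᵥ (Q *ᵥ x) + R * ((K *ᵥ x) ⬝ᵥ (K *ᵥ x))
      = x ⬝ᵥ ((Q + (κ ^ 2 * R) • (Aᵀ * M * B * Bᵀ * M * A)) *ᵥ x) := by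
        rw [hKx, Matrix.add_mulVec, Matrix.smul_mulVec, dotProduct_add, dotProduct_smul,
          smul_eq_mul]
        ring
    _ ≤ _ := dotProduct_mulVec_le_lamMax (isHermitian_add_smul_gain hQ hM _) x

end SaturatedFeedback

lemma mul_sqrt_le_rpow_sub_rpow {s t : ℝ} (hs : 0 ≤ s) (hst : s ≤ t) :
    √t * (t - s) ≤ t ^ (3 / 2 : ℝ) - s ^ (3 / 2 : ℝ) := by
  have hrpow : ∀ r : ℝ, 0 ≤ r → r ^ (3 / 2 : ℝ) = r * √r := fun r hr => by
    rw [Real.sqrt_eq_rpow, show (3 / 2 : ℝ) = 1 + 1 / 2 by norm_num,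
      Real.rpow_add' hr (by norm_num), Real.rpow_one]
  rw [hrpow t (hs.trans hst), hrpow s hs]
  linarith [mul_le_mul_of_nonneg_left (Real.sqrt_le_sqrt hst) hs]

lemma exists_saturation {m L r : ℝ} (hm : 0 ≤ m) (hmL : 1 ≤ m * L) (hr : 0 ≤ r) :
    ∃ θ : ℝ, 0 ≤ θ ∧ θ ≤ 1 ∧ θ * r ≤ m ∧ (1 - θ) * r ≤ L * (θ * r ^ 2) := by
  rcases le_or_gt r m with hrm | hmr
  · have hL : 0 ≤ L := (pos_of_mul_pos_right (one_pos.trans_le hmL) hm).le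
    refine ⟨1, zero_le_one, le_rfl, by rwa [one_mul], ?_⟩
    rw [sub_self, zero_mul, one_mul]
    positivity
  · have hr0 : 0 < r := hm.trans_lt hmr
    have hθr : m / r * r = m := div_mul_cancel₀ m hr0.ne'
    refine ⟨m / r, by positivity, (div_le_one hr0).2 hmr.le, hθr.le, ?_⟩
    calc (1 - m / r) * r ≤ r := mul_le_of_le_one_left hr (sub_le_self _ (by positivity))
      _ ≤ m * L * r := le_mul_of_one_le_left hr hmL
      _ = L * (m / r * r ^ 2) := by rw [sq, ← mul_assoc (m / r), hθr]; ring

/-- The weight `lam` of the cubic term is chosen for this inequality. -/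
lemma saturation_defect_le {n : Type*} [Fintype n] [DecidableEq n] [Nonempty n]
    {M : Matrix n n ℝ} (hM : M.PosDef) {κ L σ lam δ : ℝ} (hκ : 0 < κ) (hL : 0 ≤ L) (hσ : 0 ≤ σ)
    (hlam : lam = 2 * κ * L * σ / √(lamMin M)) {x y : n → ℝ} (hδ : 0 ≤ δ)
    (hxy : κ * (y ⬝ᵥ (M *ᵥ y)) ≤ κ * (x ⬝ᵥ (M *ᵥ x)) - δ) :
    2 * σ * √(x ⬝ᵥ x) * (L * δ) ≤
      lam * ((x ⬝ᵥ (M *ᵥ x)) ^ (3 / 2 : ℝ) - (y ⬝ᵥ (M *ᵥ y)) ^ (3 / 2 : ℝ)) := by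
  have hmin := lamMin_pos hM
  have hlam0 : 0 ≤ lam := by rw [hlam]; positivity
  have hmono : y ⬝ᵥ (M *ᵥ y) ≤ x ⬝ᵥ (M *ᵥ x) := le_of_mul_le_mul_left (by linarith) hκ
  have hnorm : √(lamMin M) * √(x ⬝ᵥ x) ≤ √(x ⬝ᵥ (M *ᵥ x)) := by
    rw [← Real.sqrt_mul hmin.le]
    exact Real.sqrt_le_sqrt (lamMin_mul_le_dotProduct_mulVec hM.isHermitian x)
  calc 2 * σ * √(x ⬝ᵥ x) * (L * δ)
      ≤ 2 * σ * √(x ⬝ᵥ x) * (L * (κ * (x ⬝ᵥ (M *ᵥ x) - y ⬝ᵥ (M *ᵥ y)))) := by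
        gcongr
        linarith
    _ = lam * (√(lamMin M) * √(x ⬝ᵥ x) * (x ⬝ᵥ (M *ᵥ x) - y ⬝ᵥ (M *ᵥ y))) := by
        rw [hlam]
        field_simp
    _ ≤ lam * (√(x ⬝ᵥ (M *ᵥ x)) * (x ⬝ᵥ (M *ᵥ x) - y ⬝ᵥ (M *ᵥ y))) := by
        gcongr
    _ ≤ _ := mul_le_mul_of_nonneg_left
        (mul_sqrt_le_rpow_sub_rpow (hM.posSemidef.dotProduct_mulVec_nonneg y) hmono) hlam0

lemma exists_termCost_step_le
    {A Q Mc Mq : Matrix (Fin 4) (Fin 4) ℝ} {B : Matrix (Fin 4) (Fin 1) ℝ}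
    {K : Matrix (Fin 1) (Fin 4) ℝ} {R κ Lu lam Θ m : ℝ} (hQ : Q.IsHermitian) (hR : 0 ≤ R)
    (hMc : Mc.PosDef) (hMcA : (Mc - Aᵀ * Mc * A).PosSemidef) (hκ : 0 < κ)
    (hκB : (1 - κ • (Bᵀ * Mc * B)).PosSemidef) (hK : K = -(κ • (Bᵀ * Mc * A)))
    (hMq : Mq.PosSemidef) (hMqA : (A + B * K)ᵀ * Mq * (A + B * K) - Mq = -1)
    (hm : 0 ≤ m) (hLu : 1 ≤ m * Lu)
    (hlam : lam = 2 * κ * Lu * sigmaMax (Aᵀ * Mq * B) / √(lamMin Mc)) (hΘ : 0 ≤ Θ)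
    (hΘQ : lamMax (Q + (κ ^ 2 * R) • (Aᵀ * Mc * B * Bᵀ * Mc * A)) ≤ Θ) (x : State) :
    ∃ u : ℝ, |u| ≤ m ∧
      termCost Mc Mq lam Θ (step A B x u) + (quad Q x + u * R * u) ≤ termCost Mc Mq lam Θ x := by
  have hLu0 : 0 ≤ Lu := (pos_of_mul_pos_right (one_pos.trans_le hLu) hm).le
  set v := K *ᵥ x with hv
  have hvv : v ⬝ᵥ v = |v 0| ^ 2 := by rw [dotProduct, Fin.sum_univ_one, sq_abs, sq]
  obtain ⟨θ, h0, h1, hθm, hθ⟩ := exists_saturation hm hLu (abs_nonneg (v 0))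
  have hstep : step A B x (θ * v 0) = A *ᵥ x + B *ᵥ (θ • v) := by
    rw [step]
    congr 2
    ext i
    rw [Subsingleton.elim i 0, Pi.smul_apply, smul_eq_mul]
  have hquad := dotProduct_mulVec_scaled_feedback_le hMq hMqA h0 h1 x
  have hgrad := dotProduct_mulVec_scaled_gradient_le hMc.isHermitian hMcA hκ.le hκB hK h0 h1 x
  have hcubic := saturation_defect_le hMc hκ hLu0 (sigmaMax_nonneg _) hlam
    (mul_nonneg h0 (dotProduct_self_nonneg v)) hgrad
  have hstage := (stage_cost_feedback_le (R := R) hQ hMc.isHermitian hK x).trans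
    (mul_le_mul_of_nonneg_right hΘQ (dotProduct_self_nonneg x))
  simp only [← hv, ← hstep, hvv, Real.sqrt_sq (abs_nonneg (v 0))] at hquad hcubic hstage
  refine ⟨θ * v 0, by rwa [abs_mul, abs_of_nonneg h0], ?_⟩
  have hinput : θ * v 0 * R * (θ * v 0) ≤ R * |v 0| ^ 2 := by
    calc θ * v 0 * R * (θ * v 0) = θ ^ 2 * (R * |v 0| ^ 2) := by rw [sq_abs]; ring
      _ ≤ R * |v 0| ^ 2 := mul_le_of_le_one_left (by positivity) (pow_le_one₀ h0 h1)
  have hdefect := mul_le_mul_of_nonneg_left hθ (a := 2 * sigmaMax (Aᵀ * Mq * B) * √(x ⬝ᵥ x))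
    (mul_nonneg (mul_nonneg zero_le_two (sigmaMax_nonneg _)) (Real.sqrt_nonneg _))
  have hterm : quad Mq (step A B x (θ * v 0)) + lam * quad Mc (step A B x (θ * v 0)) ^ (3 / 2 : ℝ) ≤
      quad Mq x + lam * quad Mc x ^ (3 / 2 : ℝ) - x ⬝ᵥ x := by
    simp only [quad]
    linarith
  have hscaled := mul_le_mul_of_nonneg_left hterm hΘ
  simp only [termCost, quad] at hscaled ⊢
  linarith

/-- Class `𝒦∞` comparison functions. They are total functions on `ℝ` of which only the restriction
to `[0, ∞)` matters. -/
structure IsClassKInfty (φ : ℝ → ℝ) : Prop where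
  continuousOn : ContinuousOn φ (Set.Ici 0)
  strictMonoOn : StrictMonoOn φ (Set.Ici 0)
  map_zero : φ 0 = 0
  tendsto_atTop : Filter.Tendsto φ Filter.atTop Filter.atTop

namespace IsClassKInfty

variable {φ ψ : ℝ → ℝ}

lemma pos (hφ : IsClassKInfty φ) {r : ℝ} (hr : 0 < r) : 0 < φ r :=
  hφ.map_zero ▸ hφ.strictMonoOn Set.self_mem_Ici hr.le hr

lemma nonneg (hφ : IsClassKInfty φ) {r : ℝ} (hr : 0 ≤ r) : 0 ≤ φ r :=
  hφ.map_zero ▸ hφ.strictMonoOn.monotoneOn Set.self_mem_Ici hr hr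

lemma le_iff_le (hφ : IsClassKInfty φ) {r s : ℝ} (hr : 0 ≤ r) (hs : 0 ≤ s) :
    φ r ≤ φ s ↔ r ≤ s :=
  hφ.strictMonoOn.le_iff_le hr hs

lemma lt_iff_lt (hφ : IsClassKInfty φ) {r s : ℝ} (hr : 0 ≤ r) (hs : 0 ≤ s) :
    φ r < φ s ↔ r < s :=
  hφ.strictMonoOn.lt_iff_lt hr hs

lemma mul_pow {a : ℝ} (ha : 0 < a) {n : ℕ} (hn : n ≠ 0) : IsClassKInfty fun r => a * r ^ n where
  continuousOn := by fun_prop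
  strictMonoOn _ hr _ _ hrs := mul_lt_mul_of_pos_left (pow_lt_pow_left₀ hrs hr hn) ha
  map_zero := by rw [zero_pow hn, mul_zero]
  tendsto_atTop := (Filter.tendsto_pow_atTop hn).const_mul_atTop ha

lemma add_mul_pow (hφ : IsClassKInfty φ) {b : ℝ} (hb : 0 ≤ b) {n : ℕ} (hn : n ≠ 0) :
    IsClassKInfty fun r => φ r + b * r ^ n where
  continuousOn := hφ.continuousOn.add (by fun_prop)
  strictMonoOn _ hr _ hs hrs := add_lt_add_of_lt_of_le (hφ.strictMonoOn hr hs hrs)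
    (mul_le_mul_of_nonneg_left (pow_le_pow_left₀ hr hrs.le n) hb)
  map_zero := by rw [hφ.map_zero, zero_pow hn, mul_zero, add_zero]
  tendsto_atTop := hφ.tendsto_atTop.atTop_add_zero_eventuallyLE <|
    (Filter.eventually_ge_atTop 0).mono fun _ hr => mul_nonneg hb (pow_nonneg hr n)

lemma exists_eq (hφ : IsClassKInfty φ) {y : ℝ} (hy : 0 ≤ y) : ∃ r, 0 ≤ r ∧ φ r = y := by
  obtain ⟨b, hyb, hb⟩ :=
    ((hφ.tendsto_atTop.eventually_ge_atTop y).and (Filter.eventually_ge_atTop 0)).exists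
  obtain ⟨r, hr, hry⟩ := intermediate_value_Icc hb (hφ.continuousOn.mono Set.Icc_subset_Ici_self)
    ⟨hφ.map_zero.trans_le hy, hyb⟩
  exact ⟨r, hr.1, hry⟩

lemma exists_stability_modulus (hφ : IsClassKInfty φ) (hψ : IsClassKInfty ψ) :
    ∃ δ : ℝ → ℝ, (∀ ε, 0 < ε → 0 < δ ε) ∧ Filter.Tendsto δ Filter.atTop Filter.atTop ∧
      ∀ ε, 0 < ε → ∀ r, 0 ≤ r → r < δ ε → ψ r < φ ε := by
  have hex : ∀ ε, ∃ r, 0 < ε → 0 ≤ r ∧ ψ r = φ ε := fun ε => by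
    by_cases hε : 0 < ε
    · exact (hψ.exists_eq (hφ.pos hε).le).imp fun _ hr _ => hr
    · exact ⟨0, fun h => absurd h hε⟩
  choose δ hδ using hex
  refine ⟨δ, fun ε hε => ?_, Filter.tendsto_atTop.2 fun c => ?_, fun ε hε r hr hrδ => ?_⟩
  · obtain ⟨hδ0, hδε⟩ := hδ ε hε
    rw [← hψ.lt_iff_lt le_rfl hδ0, hψ.map_zero, hδε]
    exact hφ.pos hε
  · filter_upwards [Filter.eventually_gt_atTop 0,
      hφ.tendsto_atTop.eventually_ge_atTop (ψ (max c 0))] with ε hε hc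
    obtain ⟨hδ0, hδε⟩ := hδ ε hε
    rw [← hδε, hψ.le_iff_le (le_max_right c 0) hδ0] at hc
    exact (le_max_left c 0).trans hc
  · obtain ⟨hδ0, hδε⟩ := hδ ε hε
    exact hδε ▸ (hψ.lt_iff_lt hr hδ0).2 hrδ

end IsClassKInfty

/-- `W` is a time-varying Lyapunov function for `x(k+1) = f(k, x(k))` on the forward invariant
family `D`, with lower bound `φ`, upper bound `ψ` and decrease `ω`. -/
structure IsLyapunov (D : ℕ → Set State) (f : ℕ → State → State) (φ ψ ω : ℝ → ℝ)
    (W : ℕ → State → ℝ) : Prop where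
  mapsTo : ∀ k, Set.MapsTo (f k) (D k) (D (k + 1))
  lower : ∀ k, ∀ x ∈ D k, φ (eucl x) ≤ W k x
  upper : ∀ k, ∀ x ∈ D k, W k x ≤ ψ (eucl x)
  descent : ∀ k, ∀ x ∈ D k, W (k + 1) (f k x) + ω (eucl x) ≤ W k x

namespace IsLyapunov

variable {D : ℕ → Set State} {f : ℕ → State → State} {φ ψ ω : ℝ → ℝ} {W : ℕ → State → ℝ}
  {k₀ : ℕ} {x : ℕ → State}

lemma solution_mem (hW : IsLyapunov D f φ ψ ω W) (hx : IsSolution f k₀ x) (h₀ : x k₀ ∈ D k₀)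
    (j : ℕ) : x (k₀ + j) ∈ D (k₀ + j) := by
  induction j with
  | zero => exact h₀
  | succ j ih =>
    rw [← add_assoc, hx (k₀ + j) (Nat.le_add_right _ _)]
    exact hW.mapsTo _ ih

lemma add_sum_le (hW : IsLyapunov D f φ ψ ω W) (hx : IsSolution f k₀ x) (h₀ : x k₀ ∈ D k₀)
    (j : ℕ) : W (k₀ + j) (x (k₀ + j)) + ∑ i ∈ Finset.range j, ω (eucl (x (k₀ + i))) ≤
      W k₀ (x k₀) := by
  induction j with
  | zero => rw [Finset.sum_range_zero, add_zero, add_zero]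
  | succ j ih =>
    have hstep := hW.descent _ _ (hW.solution_mem hx h₀ j)
    rw [← add_assoc, hx (k₀ + j) (Nat.le_add_right _ _), Finset.sum_range_succ]
    linarith

lemma eucl_lt (hW : IsLyapunov D f φ ψ ω W) (hφ : IsClassKInfty φ) (hω : IsClassKInfty ω)
    (hx : IsSolution f k₀ x) (h₀ : x k₀ ∈ D k₀) {ε : ℝ} (hε : 0 < ε)
    (hlt : ψ (eucl (x k₀)) < φ ε) {k : ℕ} (hk : k₀ ≤ k) : eucl (x k) < ε := by
  obtain ⟨j, rfl⟩ := Nat.exists_eq_add_of_le hk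
  have hsum : 0 ≤ ∑ i ∈ Finset.range j, ω (eucl (x (k₀ + i))) :=
    Finset.sum_nonneg fun _ _ => hω.nonneg (eucl_nonneg _)
  rw [← hφ.lt_iff_lt (eucl_nonneg _) hε.le]
  calc φ (eucl (x (k₀ + j))) ≤ W (k₀ + j) (x (k₀ + j)) :=
        hW.lower _ _ (hW.solution_mem hx h₀ j)
    _ ≤ W k₀ (x k₀) := (le_add_of_nonneg_right hsum).trans (hW.add_sum_le hx h₀ j)
    _ ≤ ψ (eucl (x k₀)) := hW.upper _ _ h₀
    _ < φ ε := hlt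

lemma exists_eucl_lt (hW : IsLyapunov D f φ ψ ω W) (hφ : IsClassKInfty φ)
    (hω : IsClassKInfty ω) (hx : IsSolution f k₀ x) (h₀ : x k₀ ∈ D k₀) {r : ℝ} (hr : 0 ≤ r)
    {T : ℕ} (hT : ψ (eucl (x k₀)) < T * ω r) : ∃ i < T, eucl (x (k₀ + i)) < r := by
  by_contra! hfar
  have hsum : (T : ℝ) * ω r ≤ ∑ i ∈ Finset.range T, ω (eucl (x (k₀ + i))) := by
    simpa only [Finset.card_range, nsmul_eq_mul] using Finset.card_nsmul_le_sum (Finset.range T)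
      (fun i => ω (eucl (x (k₀ + i)))) (ω r) fun i hi =>
        (hω.le_iff_le hr (eucl_nonneg _)).2 (hfar i (Finset.mem_range.1 hi))
  have hlow := (hφ.nonneg (eucl_nonneg _)).trans (hW.lower _ _ (hW.solution_mem hx h₀ T))
  linarith [hW.add_sum_le hx h₀ T, hW.upper _ _ h₀]

theorem ugas (hW : IsLyapunov D f φ ψ ω W) (hφ : IsClassKInfty φ) (hψ : IsClassKInfty ψ)
    (hω : IsClassKInfty ω) (hD : ∀ k, (0 : State) ∈ D k) : UGAS D f := by
  obtain ⟨δ, hδ0, hδtop, hδ⟩ := hφ.exists_stability_modulus hψ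
  refine ⟨hD, hW.mapsTo, ⟨δ, hδ0, hδtop, fun ε hε k₀ x h₀ hx hlt k hk => ?_⟩, ?_⟩
  · exact hW.eucl_lt hφ hω hx h₀ hε (hδ ε hε _ (eucl_nonneg _) hlt) hk
  · intro η c hη hc
    obtain ⟨T, hT⟩ := exists_nat_gt (ψ c / ω (δ η))
    rw [div_lt_iff₀ (hω.pos (hδ0 η hη))] at hT
    refine ⟨T, fun k₀ x h₀ hx hlt k hk => ?_⟩
    have hψc : ψ (eucl (x k₀)) ≤ ψ c := (hψ.le_iff_le (eucl_nonneg _) hc.le).2 hlt.le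
    obtain ⟨i, hi, hclose⟩ :=
      hW.exists_eucl_lt hφ hω hx h₀ (hδ0 η hη).le (hψc.trans_lt hT)
    have hx' : IsSolution f (k₀ + i) x := fun k hk => hx k ((Nat.le_add_right _ _).trans hk)
    exact hW.eucl_lt hφ hω hx' (hW.solution_mem hx h₀ i) hη
      (hδ η hη _ (eucl_nonneg _) hclose) (by omega)

end IsLyapunov

/-- A time-varying constrained optimal control problem. The same data are used with every horizon:
an input plan is a list whose length is the horizon. -/
structure HorizonProblem (X U : Type*) where
  next : X → U → X
  stageCost : X → U → ℝ
  terminalCost : X → ℝ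
  inputs : ℕ → X → Set U

namespace HorizonProblem

variable {X U : Type*} (P : HorizonProblem X U)

/-- Cost of an input plan from a given state. -/
def cost : X → List U → ℝ
  | x, [] => P.terminalCost x
  | x, u :: us => P.stageCost x u + cost (P.next x u) us

/-- The plan satisfies the input constraints from a given time and state on. -/
def IsFeasible : ℕ → X → List U → Prop
  | _, _, [] => True
  | k, x, u :: us => u ∈ P.inputs k x ∧ IsFeasible (k + 1) (P.next x u) us

/-- The feasible plans of horizon `n` at time `k` from `x`. -/
def plans (n k : ℕ) (x : X) : Set (List U) :=
  {us | us.length = n ∧ P.IsFeasible k x us}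

/-- The states from which the problem of horizon `n` is feasible at time `k`. -/
def domain (n k : ℕ) : Set X :=
  {x | (P.plans n k x).Nonempty}

/-- Optimal value of the problem of horizon `n`; the junk value `0` outside `domain n k`. -/
def value (n k : ℕ) (x : X) : ℝ :=
  sInf (P.cost x '' P.plans n k x)

/-- A terminal family: every admissible input leads into it, and on it some admissible input lowers
the terminal cost by at least the stage cost. -/
structure IsTerminal (S : ℕ → Set X) : Prop where
  next_mem : ∀ {k x u}, u ∈ P.inputs k x → P.next x u ∈ S (k + 1)
  exists_descent : ∀ {k x}, x ∈ S k → ∃ u ∈ P.inputs k x,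
    P.stageCost x u + P.terminalCost (P.next x u) ≤ P.terminalCost x

/-- `law` returns the first input of an optimal plan wherever the problem is feasible. -/
def IsRecedingHorizonLaw (n : ℕ) (law : ℕ → X → U) : Prop :=
  ∀ k, ∀ x ∈ P.domain n k, ∃ us, law k x :: us ∈ P.plans n k x ∧
    IsMinOn (P.cost x) (P.plans n k x) (law k x :: us)

variable {P} {S : ℕ → Set X} {n k : ℕ} {x : X} {us : List U} {law : ℕ → X → U}

lemma cons_mem_plans {u : U} : u :: us ∈ P.plans (n + 1) k x ↔
    u ∈ P.inputs k x ∧ us ∈ P.plans n (k + 1) (P.next x u) := by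
  simp only [plans, Set.mem_ofPred_eq, List.length_cons, Nat.add_right_cancel_iff, IsFeasible]
  exact and_left_comm

lemma inputs_nonempty (hx : x ∈ P.domain (n + 1) k) : (P.inputs k x).Nonempty := by
  obtain ⟨us, hlen, hus⟩ := hx
  obtain ⟨u, us, rfl⟩ := List.exists_cons_of_length_eq_add_one hlen
  exact ⟨u, hus.1⟩

lemma IsTerminal.exists_append_mem_plans (hS : P.IsTerminal S) (hx : x ∈ S k)
    (hus : us ∈ P.plans n k x) :
    ∃ u, us ++ [u] ∈ P.plans (n + 1) k x ∧ P.cost x (us ++ [u]) ≤ P.cost x us := by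
  induction us generalizing n k x with
  | nil =>
    obtain ⟨u, hu, hle⟩ := hS.exists_descent hx
    obtain rfl : 0 = n := hus.1
    exact ⟨u, ⟨rfl, hu, trivial⟩, hle⟩
  | cons v us ih =>
    obtain rfl : us.length + 1 = n := hus.1
    obtain ⟨hv, hus⟩ := cons_mem_plans.1 hus
    obtain ⟨u, hu, hle⟩ := ih (hS.next_mem hv) hus
    exact ⟨u, cons_mem_plans.2 ⟨hv, hu⟩, add_le_add_right hle _⟩

lemma IsTerminal.exists_plan_cost_le (hS : P.IsTerminal S) (hx : x ∈ S k) (n : ℕ) :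
    ∃ us ∈ P.plans n k x, P.cost x us ≤ P.terminalCost x := by
  induction n with
  | zero => exact ⟨[], ⟨rfl, trivial⟩, le_rfl⟩
  | succ n ih =>
    obtain ⟨us, hus, hle⟩ := ih
    obtain ⟨u, hu, hle'⟩ := hS.exists_append_mem_plans hx hus
    exact ⟨us ++ [u], hu, hle'.trans hle⟩

lemma IsTerminal.subset_domain (hS : P.IsTerminal S) (n k : ℕ) : S k ⊆ P.domain n k :=
  fun _ hx => (hS.exists_plan_cost_le hx n).imp fun _ h => h.1

lemma cost_nonneg (hstage : ∀ x u, 0 ≤ P.stageCost x u) (hterm : ∀ x, 0 ≤ P.terminalCost x)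
    (x : X) (us : List U) : 0 ≤ P.cost x us := by
  induction us generalizing x with
  | nil => exact hterm x
  | cons u us ih => exact add_nonneg (hstage x u) (ih _)

lemma value_le_cost (hcost : ∀ us, 0 ≤ P.cost x us) (hus : us ∈ P.plans n k x) :
    P.value n k x ≤ P.cost x us :=
  csInf_le ⟨0, Set.forall_mem_image.2 fun us _ => hcost us⟩ (Set.mem_image_of_mem _ hus)

lemma value_eq_cost (hus : us ∈ P.plans n k x) (hmin : IsMinOn (P.cost x) (P.plans n k x) us) :
    P.value n k x = P.cost x us :=
  IsLeast.csInf_eq ⟨Set.mem_image_of_mem _ hus, Set.forall_mem_image.2 fun _ h => hmin h⟩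

lemma IsTerminal.value_succ_le (hS : P.IsTerminal S) (hcost : ∀ us, 0 ≤ P.cost x us) {u : U}
    (hu : u ∈ P.inputs k x) :
    P.value (n + 1) k x ≤ P.stageCost x u + P.terminalCost (P.next x u) := by
  obtain ⟨us, hus, hle⟩ := hS.exists_plan_cost_le (hS.next_mem hu) n
  exact (value_le_cost hcost (cons_mem_plans.2 ⟨hu, hus⟩)).trans (add_le_add_right hle _)

namespace IsRecedingHorizonLaw

lemma stageCost_le_value (hlaw : P.IsRecedingHorizonLaw n law)
    (hcost : ∀ x us, 0 ≤ P.cost x us) (hx : x ∈ P.domain n k) :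
    P.stageCost x (law k x) ≤ P.value n k x := by
  obtain ⟨us, hus, hmin⟩ := hlaw k x hx
  rw [value_eq_cost hus hmin]
  exact le_add_of_nonneg_right (hcost _ us)

lemma exists_shifted_plan (hlaw : P.IsRecedingHorizonLaw n law) (hS : P.IsTerminal S)
    (hx : x ∈ P.domain n k) :
    ∃ us ∈ P.plans n (k + 1) (P.next x (law k x)),
      P.cost (P.next x (law k x)) us + P.stageCost x (law k x) ≤ P.value n k x := by
  obtain ⟨us, hus, hmin⟩ := hlaw k x hx
  obtain rfl : us.length + 1 = n := hus.1
  obtain ⟨hu, htail⟩ := cons_mem_plans.1 hus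
  obtain ⟨v, hv, hle⟩ := hS.exists_append_mem_plans (hS.next_mem hu) htail
  refine ⟨us ++ [v], hv, ?_⟩
  rw [value_eq_cost hus hmin, cost, add_comm]
  exact add_le_add_right hle _

theorem ugas {P : HorizonProblem State U} {S : ℕ → Set State} {law : ℕ → State → U}
    (hlaw : P.IsRecedingHorizonLaw (n + 1) law) (hS : P.IsTerminal S) (h0 : ∀ k, 0 ∈ S k)
    {φ ψ : ℝ → ℝ} (hφ : IsClassKInfty φ) (hψ : IsClassKInfty ψ)
    (hstage : ∀ x u, φ (eucl x) ≤ P.stageCost x u) (hterm : ∀ x, 0 ≤ P.terminalCost x)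
    (hcontrol : ∀ k x, (P.inputs k x).Nonempty → ∃ u ∈ P.inputs k x,
      P.stageCost x u + P.terminalCost (P.next x u) ≤ ψ (eucl x)) :
    UGAS (P.domain (n + 1)) fun k x => P.next x (law k x) := by
  have hcost : ∀ x us, 0 ≤ P.cost x us :=
    cost_nonneg (fun x u => (hφ.nonneg (eucl_nonneg x)).trans (hstage x u)) hterm
  have hlyap : IsLyapunov (P.domain (n + 1)) (fun k x => P.next x (law k x)) φ ψ φ
      (P.value (n + 1)) :=
    { mapsTo := fun k x hx => (hlaw.exists_shifted_plan hS hx).imp fun _ h => h.1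
      lower := fun k x hx => (hstage x _).trans (hlaw.stageCost_le_value hcost hx)
      upper := fun k x hx => by
        obtain ⟨u, hu, hle⟩ := hcontrol k x (inputs_nonempty hx)
        exact (hS.value_succ_le (hcost x) hu).trans hle
      descent := fun k x hx => by
        obtain ⟨us, hus, hle⟩ := hlaw.exists_shifted_plan hS hx
        exact (add_le_add (value_le_cost (hcost _) hus) (hstage x _)).trans hle }
  exact hlyap.ugas hφ hψ hφ fun k => hS.subset_domain _ k (h0 k)

end IsRecedingHorizonLaw
end HorizonProblem

section ExactDiscretization

open NormedSpace

lemma hasDerivAt_exp_neg_smul_apply {n : Type*} [Fintype n] [DecidableEq n] (A : Matrix n n ℝ)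
    (t : ℝ) (i j : n) :
    HasDerivAt (fun s : ℝ => exp (-s • A) i j) (-(A * exp (-t • A)) i j) t := by
  open scoped Matrix.Norms.Operator in
  have hexp := hasDerivAt_exp_smul_const' (𝕂 := ℝ) A (-t)
  have hneg := hexp.scomp t (hasDerivAt_neg t)
  rw [neg_one_smul] at hneg
  exact hasDerivAt_pi.1 (hasDerivAt_pi.1 hneg i) j

lemma vecMul_exp_smul_eq_of_hasDerivAt {n : Type*} [Fintype n] [DecidableEq n]
    {A : Matrix n n ℝ} {r : ℝ → n → ℝ} (hr : ∀ t, HasDerivAt r (r t ᵥ* A) t) (t : ℝ) :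
    r 0 ᵥ* exp (t • A) = r t := by
  have hderiv : ∀ s, HasDerivAt (fun s => r s ᵥ* exp (-s • A)) 0 s := by
    intro s
    refine hasDerivAt_pi.2 fun j => ?_
    have hsum := HasDerivAt.fun_sum (u := Finset.univ) fun i _ =>
      (hasDerivAt_pi.1 (hr s) i).mul (hasDerivAt_exp_neg_smul_apply A s i j)
    refine hsum.congr_deriv ?_
    rw [Finset.sum_add_distrib]
    simp only [mul_neg, Finset.sum_neg_distrib]
    exact add_neg_eq_zero.2 (congrFun (Matrix.vecMul_vecMul (r s) A _) j)
  have hconst : r t ᵥ* exp (-t • A) = r 0 := by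
    have h := is_const_of_deriv_eq_zero (fun s => (hderiv s).differentiableAt)
      (fun s => (hderiv s).deriv) t 0
    simpa only [neg_zero, zero_smul, exp_zero, Matrix.vecMul_one] using h
  have hinv : exp (-t • A) * exp (t • A) = 1 := by
    rw [← Matrix.exp_add_of_commute _ _ ((Commute.refl A).smul_left _ |>.smul_right _), ← add_smul,
      neg_add_cancel, zero_smul, exp_zero]
  rw [← hconst, Matrix.vecMul_vecMul, hinv, Matrix.vecMul_one]

variable (d γ : ℝ)

lemma hasDerivAt_exp_neg_div (s : ℝ) :
    HasDerivAt (fun s : ℝ => Real.exp (-(s / γ))) (Real.exp (-(s / γ)) * -(1 / γ)) s :=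
  ((hasDerivAt_id s).div_const γ).neg.exp

lemma hasDerivAt_exp_neg_div_mul (s : ℝ) :
    HasDerivAt (fun s : ℝ => Real.exp (-(s / γ)) * (s / γ))
      (Real.exp (-(s / γ)) * (1 / γ - s / γ * (1 / γ))) s :=
  ((hasDerivAt_exp_neg_div γ s).mul ((hasDerivAt_id' s).div_const γ)).congr_deriv (by ring)

lemma single_three_vecMul_Acont :
    Pi.single 3 1 ᵥ* Acont d γ = -(1 / γ) • (Pi.single 3 1 : State) := by
  ext j
  fin_cases j <;> simp [Acont]

lemma single_two_vecMul_Acont : Pi.single 2 1 ᵥ* Acont d γ =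
    -(1 / γ) • (Pi.single 2 1 : State) + (1 / γ) • Pi.single 3 1 := by
  ext j
  fin_cases j <;> simp [Acont]

lemma exp_smul_Acont_row_three (s : ℝ) :
    exp (s • Acont d γ) 3 = Real.exp (-(s / γ)) • Pi.single 3 1 := by
  have hr : ∀ t, HasDerivAt (fun s : ℝ => Real.exp (-(s / γ)) • (Pi.single 3 1 : State))
      ((Real.exp (-(t / γ)) • Pi.single 3 1) ᵥ* Acont d γ) t := by
    intro t
    refine ((hasDerivAt_exp_neg_div γ t).smul_const _).congr_deriv ?_
    rw [Matrix.smul_vecMul, single_three_vecMul_Acont, smul_smul]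
  have h := vecMul_exp_smul_eq_of_hasDerivAt hr s
  rwa [zero_div, neg_zero, Real.exp_zero, one_smul, Matrix.single_one_vecMul] at h

lemma exp_smul_Acont_row_two (s : ℝ) : exp (s • Acont d γ) 2 =
    Real.exp (-(s / γ)) • Pi.single 2 1 + (Real.exp (-(s / γ)) * (s / γ)) • Pi.single 3 1 := by
  have hr : ∀ t, HasDerivAt (fun s : ℝ => Real.exp (-(s / γ)) • (Pi.single 2 1 : State) +
        (Real.exp (-(s / γ)) * (s / γ)) • Pi.single 3 1)
      ((Real.exp (-(t / γ)) • Pi.single 2 1 +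
        (Real.exp (-(t / γ)) * (t / γ)) • Pi.single 3 1) ᵥ* Acont d γ) t := by
    intro t
    refine (((hasDerivAt_exp_neg_div γ t).smul_const _).add
      ((hasDerivAt_exp_neg_div_mul γ t).smul_const _)).congr_deriv ?_
    rw [Matrix.add_vecMul, Matrix.smul_vecMul, Matrix.smul_vecMul, single_two_vecMul_Acont,
      single_three_vecMul_Acont]
    module
  have h := vecMul_exp_smul_eq_of_hasDerivAt hr s
  rwa [zero_div, neg_zero, Real.exp_zero, one_smul, mul_zero, zero_smul, add_zero,
    Matrix.single_one_vecMul] at h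

lemma Bd_three (h : ℝ) : Bd d γ h 3 0 = 1 - alpha h γ := by
  have hint : ∀ s : ℝ, (exp (s • Acont d γ) * Bcont γ) 3 0 = -(Real.exp (-(s / γ)) * -(1 / γ)) := by
    intro s
    simp [Matrix.mul_apply, Fin.sum_univ_four, exp_smul_Acont_row_three, Bcont]
  calc Bd d γ h 3 0 = ∫ s in (0 : ℝ)..h, -(Real.exp (-(s / γ)) * -(1 / γ)) := by
        simp only [Bd, Matrix.of_apply, hint]
    _ = -Real.exp (-(h / γ)) - -Real.exp (-(0 / γ)) :=
        intervalIntegral.integral_eq_sub_of_hasDerivAt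
          (fun s _ => (hasDerivAt_exp_neg_div γ s).neg)
          (Continuous.intervalIntegrable (by fun_prop) _ _)
    _ = 1 - alpha h γ := by
        rw [zero_div, neg_zero, Real.exp_zero, alpha]
        ring

lemma Bd_two (h : ℝ) : Bd d γ h 2 0 = 1 - alpha h γ - beta h γ := by
  have hint : ∀ s : ℝ, (exp (s • Acont d γ) * Bcont γ) 2 0 =
      -(Real.exp (-(s / γ)) * -(1 / γ) + Real.exp (-(s / γ)) * (1 / γ - s / γ * (1 / γ))) := by
    intro s
    have hmul : (exp (s • Acont d γ) * Bcont γ) 2 0 = Real.exp (-(s / γ)) * (s / γ) * (1 / γ) := by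
      simp [Matrix.mul_apply, Fin.sum_univ_four, exp_smul_Acont_row_two, Bcont]
    rw [hmul]
    ring
  calc Bd d γ h 2 0 = ∫ s in (0 : ℝ)..h,
        -(Real.exp (-(s / γ)) * -(1 / γ) + Real.exp (-(s / γ)) * (1 / γ - s / γ * (1 / γ))) := by
        simp only [Bd, Matrix.of_apply, hint]
    _ = -(Real.exp (-(h / γ)) + Real.exp (-(h / γ)) * (h / γ)) -
          -(Real.exp (-(0 / γ)) + Real.exp (-(0 / γ)) * (0 / γ)) :=
        intervalIntegral.integral_eq_sub_of_hasDerivAt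
          (fun s _ => ((hasDerivAt_exp_neg_div γ s).add (hasDerivAt_exp_neg_div_mul γ s)).neg)
          (Continuous.intervalIntegrable (by fun_prop) _ _)
    _ = 1 - alpha h γ - beta h γ := by
        rw [zero_div, neg_zero, Real.exp_zero, mul_zero, alpha, beta]
        ring

variable (h : ℝ) (x : State) (u : ℝ)

lemma step_Ad_Bd_three :
    step (Ad d γ h) (Bd d γ h) x u 3 = alpha h γ * x 3 + (1 - alpha h γ) * u := by
  simp [step, Matrix.mulVec, dotProduct, Fin.sum_univ_four, Ad, exp_smul_Acont_row_three, Bd_three,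
    alpha]

lemma step_Ad_Bd_two : step (Ad d γ h) (Bd d γ h) x u 2 =
    alpha h γ * x 2 + beta h γ * x 3 + (1 - alpha h γ - beta h γ) * u := by
  simp [step, Matrix.mulVec, dotProduct, Fin.sum_univ_four, Ad, exp_smul_Acont_row_two, Bd_two,
    alpha, beta, mul_comm (h / γ)]

end ExactDiscretization

section InputConstraints

lemma iInf_le_of_forall_nonneg {ι : Type*} {f : ι → ℝ} (hf : ∀ i, 0 ≤ f i) (i : ι) :
    ⨅ j, f j ≤ f i :=
  ciInf_le ⟨0, Set.forall_mem_range.2 hf⟩ i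

variable {Δ : ℝ → ℝ} {d h γ : ℝ}

lemma alpha_pos : 0 < alpha h γ :=
  Real.exp_pos _

lemma beta_pos (hh : 0 < h) (hγ : 0 < γ) : 0 < beta h γ :=
  mul_pos (div_pos hh hγ) (Real.exp_pos _)

lemma alpha_add_beta_lt_one (hh : 0 < h) (hγ : 0 < γ) : alpha h γ + beta h γ < 1 :=
  calc alpha h γ + beta h γ = (h / γ + 1) * Real.exp (-(h / γ)) := by
        rw [alpha, beta]
        ring
    _ < Real.exp (h / γ) * Real.exp (-(h / γ)) :=
        mul_lt_mul_of_pos_right (Real.add_one_lt_exp (div_pos hh hγ).ne') (Real.exp_pos _)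
    _ = 1 := by rw [← Real.exp_add, add_neg_cancel, Real.exp_zero]

lemma alpha_lt_one (hh : 0 < h) (hγ : 0 < γ) : alpha h γ < 1 :=
  (le_add_of_nonneg_right (beta_pos hh hγ).le).trans_lt (alpha_add_beta_lt_one hh hγ)

lemma boundAt_succ (Δ : ℝ → ℝ) (h : ℝ) (i k : ℕ) :
    boundAt Δ h (i + 1) k = boundAt Δ h i (k + 1) := by
  simp only [boundAt, Nat.cast_add, Nat.cast_one, add_assoc, add_comm 1 (i : ℝ)]

lemma boundAt_nonneg (hh : 0 ≤ h) (hΔ : ∀ t, 0 ≤ t → 0 ≤ Δ t) (i k : ℕ) : 0 ≤ boundAt Δ h i k :=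
  Real.sInf_nonneg <| Set.forall_mem_image.2 fun t ht => hΔ t (le_trans (by positivity) ht.1)

lemma alpha_mul_boundAt_le (hh : 0 < h) (hγ : 0 < γ) (hΔ : ∀ t, 0 ≤ t → 0 ≤ Δ t)
    (hgrowth : ∀ k, (alpha h γ + beta h γ) * boundAt Δ h 0 k ≤ boundAt Δ h 0 (k + 1)) (k : ℕ) :
    alpha h γ * boundAt Δ h 0 k ≤ boundAt Δ h 0 (k + 1) :=
  (mul_le_mul_of_nonneg_right (le_add_of_nonneg_right (beta_pos hh hγ).le)
    (boundAt_nonneg hh.le hΔ 0 k)).trans (hgrowth k)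

lemma deltaStar_nonneg (hh : 0 < h) (hγ : 0 < γ) (hΔ : ∀ t, 0 ≤ t → 0 ≤ Δ t)
    (hgrowth : ∀ k, (alpha h γ + beta h γ) * boundAt Δ h 0 k ≤ boundAt Δ h 0 (k + 1)) :
    0 ≤ deltaStar Δ h γ := by
  have hαβ : 0 ≤ 1 - alpha h γ - beta h γ := by linarith [alpha_add_beta_lt_one hh hγ]
  have hα : 0 ≤ 1 - alpha h γ := sub_nonneg.2 (alpha_lt_one hh hγ).le
  refine le_min ?_ (le_min ?_ ?_)
  · exact mul_nonneg (inv_nonneg.2 hαβ) (Real.iInf_nonneg fun k => sub_nonneg.2 (hgrowth k))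
  · exact mul_nonneg (inv_nonneg.2 hα)
      (Real.iInf_nonneg fun k => sub_nonneg.2 (alpha_mul_boundAt_le hh hγ hΔ hgrowth k))
  · exact Real.iInf_nonneg (boundAt_nonneg hh.le hΔ 0)

lemma deltaStar_le_boundAt (hh : 0 ≤ h) (hΔ : ∀ t, 0 ≤ t → 0 ≤ Δ t) (k : ℕ) :
    deltaStar Δ h γ ≤ boundAt Δ h 0 k :=
  (min_le_right _ _).trans <| (min_le_right _ _).trans <|
    iInf_le_of_forall_nonneg (boundAt_nonneg hh hΔ 0) k

lemma alpha_add_beta_mul_boundAt_add_le (hh : 0 < h) (hγ : 0 < γ)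
    (hgrowth : ∀ k, (alpha h γ + beta h γ) * boundAt Δ h 0 k ≤ boundAt Δ h 0 (k + 1)) (k : ℕ) :
    (alpha h γ + beta h γ) * boundAt Δ h 0 k + (1 - alpha h γ - beta h γ) * deltaStar Δ h γ ≤
      boundAt Δ h 0 (k + 1) := by
  have hαβ : 0 < 1 - alpha h γ - beta h γ := by linarith [alpha_add_beta_lt_one hh hγ]
  have hinf := iInf_le_of_forall_nonneg (fun k => sub_nonneg.2 (hgrowth k)) k
  have hδ : deltaStar Δ h γ ≤ _ := min_le_left _ _
  rw [le_inv_mul_iff₀ hαβ] at hδ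
  linarith

lemma alpha_mul_boundAt_add_le (hh : 0 < h) (hγ : 0 < γ) (hΔ : ∀ t, 0 ≤ t → 0 ≤ Δ t)
    (hgrowth : ∀ k, (alpha h γ + beta h γ) * boundAt Δ h 0 k ≤ boundAt Δ h 0 (k + 1)) (k : ℕ) :
    alpha h γ * boundAt Δ h 0 k + (1 - alpha h γ) * deltaStar Δ h γ ≤ boundAt Δ h 0 (k + 1) := by
  have hinf := iInf_le_of_forall_nonneg
    (fun k => sub_nonneg.2 (alpha_mul_boundAt_le hh hγ hΔ hgrowth k)) k
  have hδ : deltaStar Δ h γ ≤ _ := (min_le_right _ _).trans (min_le_left _ _)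
  rw [le_inv_mul_iff₀ (sub_pos.2 (alpha_lt_one hh hγ))] at hδ
  linarith

/-- The states at time `k` whose last two coordinates are bounded by `D k`. -/
def box (D : ℕ → ℝ) (k : ℕ) : Set State :=
  {x | |x 2| ≤ D k ∧ |x 3| ≤ D k}

lemma zero_mem_box {D : ℕ → ℝ} (hD : ∀ k, 0 ≤ D k) (k : ℕ) : 0 ∈ box D k := by
  simpa [box] using hD k

lemma mem_Icc_uMin_uMax_iff (hh : 0 < h) (hγ : 0 < γ) (i k : ℕ) (x : State) (u : ℝ) :
    u ∈ Set.Icc (uMin Δ h γ i k x) (uMax Δ h γ i k x) ↔ |u| ≤ boundAt Δ h i k ∧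
      |alpha h γ * x 2 + beta h γ * x 3 + (1 - alpha h γ - beta h γ) * u| ≤
        boundAt Δ h (i + 1) k ∧
      |alpha h γ * x 3 + (1 - alpha h γ) * u| ≤ boundAt Δ h (i + 1) k := by
  have hαβ : 0 < 1 - alpha h γ - beta h γ := by linarith [alpha_add_beta_lt_one hh hγ]
  have hα : 0 < 1 - alpha h γ := sub_pos.2 (alpha_lt_one hh hγ)
  simp only [Set.mem_Icc, uMin, uMax, max_le_iff, le_min_iff, neg_le (b := u),
    inv_mul_le_iff₀ hαβ, le_inv_mul_iff₀ hαβ, le_inv_mul_iff₀ hα, abs_le]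
  constructor
  · rintro ⟨⟨_, _, _⟩, _, _, _⟩
    refine ⟨⟨?_, ?_⟩, ⟨?_, ?_⟩, ?_, ?_⟩ <;> linarith
  · rintro ⟨⟨_, _⟩, ⟨_, _⟩, _, _⟩
    refine ⟨⟨?_, ?_, ?_⟩, ?_, ?_, ?_⟩ <;> linarith

lemma step_mem_box (hh : 0 < h) (hγ : 0 < γ) {k : ℕ} {x : State} {u : ℝ}
    (hu : u ∈ Set.Icc (uMin Δ h γ 0 k x) (uMax Δ h γ 0 k x)) :
    step (Ad d γ h) (Bd d γ h) x u ∈ box (boundAt Δ h 0) (k + 1) := by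
  simpa only [box, Set.mem_ofPred_eq, step_Ad_Bd_two, step_Ad_Bd_three, ← boundAt_succ] using
    ((mem_Icc_uMin_uMax_iff hh hγ 0 k x u).1 hu).2

lemma mem_Icc_of_abs_le_deltaStar (hh : 0 < h) (hγ : 0 < γ) (hΔ : ∀ t, 0 ≤ t → 0 ≤ Δ t)
    (hgrowth : ∀ k, (alpha h γ + beta h γ) * boundAt Δ h 0 k ≤ boundAt Δ h 0 (k + 1))
    {k : ℕ} {x : State} {u : ℝ} (hx : x ∈ box (boundAt Δ h 0) k) (hu : |u| ≤ deltaStar Δ h γ) :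
    u ∈ Set.Icc (uMin Δ h γ 0 k x) (uMax Δ h γ 0 k x) := by
  obtain ⟨h2, h3⟩ := hx
  have hα : 0 ≤ alpha h γ := alpha_pos.le
  have hβ : 0 ≤ beta h γ := (beta_pos hh hγ).le
  have hα' : 0 ≤ 1 - alpha h γ := sub_nonneg.2 (alpha_lt_one hh hγ).le
  have hαβ' : 0 ≤ 1 - alpha h γ - beta h γ := by linarith [alpha_add_beta_lt_one hh hγ]
  rw [mem_Icc_uMin_uMax_iff hh hγ, boundAt_succ]
  refine ⟨hu.trans (deltaStar_le_boundAt hh.le hΔ k), ?_, ?_⟩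
  · calc |alpha h γ * x 2 + beta h γ * x 3 + (1 - alpha h γ - beta h γ) * u|
        ≤ alpha h γ * |x 2| + beta h γ * |x 3| + (1 - alpha h γ - beta h γ) * |u| := by
          refine (abs_add_three _ _ _).trans_eq ?_
          rw [abs_mul, abs_mul, abs_mul, abs_of_nonneg hα, abs_of_nonneg hβ, abs_of_nonneg hαβ']
      _ ≤ alpha h γ * boundAt Δ h 0 k + beta h γ * boundAt Δ h 0 k +
            (1 - alpha h γ - beta h γ) * deltaStar Δ h γ := by gcongr
      _ ≤ boundAt Δ h 0 (k + 1) := by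
          rw [← add_mul]
          exact alpha_add_beta_mul_boundAt_add_le hh hγ hgrowth k
  · calc |alpha h γ * x 3 + (1 - alpha h γ) * u|
        ≤ alpha h γ * |x 3| + (1 - alpha h γ) * |u| := by
          refine (abs_add_le _ _).trans_eq ?_
          rw [abs_mul, abs_mul, abs_of_nonneg hα, abs_of_nonneg hα']
      _ ≤ alpha h γ * boundAt Δ h 0 k + (1 - alpha h γ) * deltaStar Δ h γ := by gcongr
      _ ≤ boundAt Δ h 0 (k + 1) := alpha_mul_boundAt_add_le hh hγ hΔ hgrowth k

lemma exists_mem_Icc_abs_le {a b t : ℝ} (hab : (Set.Icc a b).Nonempty) (ht : 0 ≤ t) (ha : a ≤ t)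
    (hb : -t ≤ b) : ∃ u ∈ Set.Icc a b, |u| ≤ t :=
  ⟨max a (min b 0), ⟨le_max_left _ _, max_le (Set.nonempty_Icc.1 hab) (min_le_left _ _)⟩,
    abs_le.2 ⟨le_max_of_le_right (le_min hb (neg_nonpos.2 ht)),
      max_le ha ((min_le_right _ _).trans ht)⟩⟩

lemma neg_uMin_neg (i k : ℕ) (x : State) : -uMin Δ h γ i k (-x) = uMax Δ h γ i k x := by
  rw [uMin, uMax, neg_eq_iff_eq_neg, ← max_neg_neg, ← max_neg_neg]
  simp only [Pi.neg_apply]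
  ring_nf

lemma eucl_neg (x : State) : eucl (-x) = eucl x := by
  rw [eucl, eucl, neg_dotProduct_neg]

lemma uMin_le_mul_eucl (hh : 0 < h) (hγ : 0 < γ) (hΔ : ∀ t, 0 ≤ t → 0 ≤ Δ t) (i k : ℕ)
    (x : State) : uMin Δ h γ i k x ≤ (1 - alpha h γ - beta h γ)⁻¹ * eucl x := by
  have hα : 0 < alpha h γ := alpha_pos
  have hβ : 0 < beta h γ := beta_pos hh hγ
  have hlt := alpha_add_beta_lt_one hh hγ
  have hαβ : 0 < 1 - alpha h γ - beta h γ := by linarith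
  have hr := eucl_nonneg x
  have hD := boundAt_nonneg hh.le hΔ (i + 1) k
  have h2 := neg_le_of_abs_le (abs_apply_le_eucl x 2)
  have h3 := neg_le_of_abs_le (abs_apply_le_eucl x 3)
  have hα3 : alpha h γ * -x 3 ≤ eucl x := by nlinarith
  refine max_le ?_ (max_le ?_ ?_)
  · exact (neg_nonpos.2 (boundAt_nonneg hh.le hΔ i k)).trans (by positivity)
  · refine mul_le_mul_of_nonneg_left ?_ (inv_pos.2 hαβ).le
    nlinarith
  · calc -((1 - alpha h γ)⁻¹ * (boundAt Δ h (i + 1) k + alpha h γ * x 3))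
        = (1 - alpha h γ)⁻¹ * (alpha h γ * -x 3 - boundAt Δ h (i + 1) k) := by ring
      _ ≤ (1 - alpha h γ)⁻¹ * eucl x :=
          mul_le_mul_of_nonneg_left (by linarith) (inv_nonneg.2 (by linarith))
      _ ≤ (1 - alpha h γ - beta h γ)⁻¹ * eucl x :=
          mul_le_mul_of_nonneg_right (inv_anti₀ hαβ (by linarith)) hr

lemma exists_mem_Icc_abs_le_mul_eucl (hh : 0 < h) (hγ : 0 < γ) (hΔ : ∀ t, 0 ≤ t → 0 ≤ Δ t)
    {i k : ℕ} {x : State} (hne : (Set.Icc (uMin Δ h γ i k x) (uMax Δ h γ i k x)).Nonempty) :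
    ∃ u ∈ Set.Icc (uMin Δ h γ i k x) (uMax Δ h γ i k x),
      |u| ≤ (1 - alpha h γ - beta h γ)⁻¹ * eucl x := by
  have hαβ : 0 < 1 - alpha h γ - beta h γ := by linarith [alpha_add_beta_lt_one hh hγ]
  refine exists_mem_Icc_abs_le hne (mul_nonneg (inv_pos.2 hαβ).le (eucl_nonneg x))
    (uMin_le_mul_eucl hh hγ hΔ i k x) ?_
  rw [← neg_uMin_neg, ← eucl_neg x]
  exact neg_le_neg (uMin_le_mul_eucl hh hγ hΔ i k (-x))

end InputConstraints

section AxisProblem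

variable {Δ : ℝ → ℝ} {d γ h : ℝ} {Q : Matrix (Fin 4) (Fin 4) ℝ} {R : ℝ} {V : State → ℝ}
  {n k : ℕ} {x : State}

/-- The problems over all horizons as one horizon problem. Its input constraint is the one of
prediction step `0`, since prediction step `i` at instant `k` amounts to step `0` at `k + i`. -/
def axisProblem (Δ : ℝ → ℝ) (d γ h : ℝ) (Q : Matrix (Fin 4) (Fin 4) ℝ) (R : ℝ) (V : State → ℝ) :
    HorizonProblem State ℝ where
  next := step (Ad d γ h) (Bd d γ h)
  stageCost x u := quad Q x + u * R * u
  terminalCost := V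
  inputs k x := Set.Icc (uMin Δ h γ 0 k x) (uMax Δ h γ 0 k x)

lemma uMin_succ (i k : ℕ) (x : State) : uMin Δ h γ (i + 1) k x = uMin Δ h γ i (k + 1) x := by
  simp only [uMin, boundAt_succ]

lemma uMax_succ (i k : ℕ) (x : State) : uMax Δ h γ (i + 1) k x = uMax Δ h γ i (k + 1) x := by
  simp only [uMax, boundAt_succ]

lemma pred_succ (A : Matrix (Fin 4) (Fin 4) ℝ) (B : Matrix (Fin 4) (Fin 1) ℝ) (x : State)
    (U : Fin (n + 1) → ℝ) (i : ℕ) :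
    pred A B x U (i + 1) = pred A B (step A B x (U 0)) (Fin.tail U) i := by
  induction i with
  | zero => simp [pred]
  | succ i ih =>
    rw [pred, ih, pred]
    simp [Fin.tail]

lemma feasible_succ_iff {U : Fin (n + 1) → ℝ} : Feasible Δ d γ h k x U ↔
    U 0 ∈ Set.Icc (uMin Δ h γ 0 k x) (uMax Δ h γ 0 k x) ∧
      Feasible Δ d γ h (k + 1) (step (Ad d γ h) (Bd d γ h) x (U 0)) (Fin.tail U) := by
  simp only [Feasible, Fin.forall_fin_succ, Fin.val_zero, Fin.val_succ, pred_succ, uMin_succ,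
    uMax_succ]
  rfl

lemma cost_succ (A : Matrix (Fin 4) (Fin 4) ℝ) (B : Matrix (Fin 4) (Fin 1) ℝ) (x : State)
    (U : Fin (n + 1) → ℝ) : cost A B Q R V x U =
      quad Q x + U 0 * R * U 0 + cost A B Q R V (step A B x (U 0)) (Fin.tail U) := by
  simp only [cost, Fin.sum_univ_succ, Fin.val_succ, pred_succ]
  exact add_left_comm _ _ _

lemma feasible_iff_isFeasible_ofFn {U : Fin n → ℝ} :
    Feasible Δ d γ h k x U ↔ (axisProblem Δ d γ h Q R V).IsFeasible k x (List.ofFn U) := by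
  induction n generalizing k x with
  | zero => simp [Feasible, HorizonProblem.IsFeasible]
  | succ n ih =>
    rw [feasible_succ_iff, ih, List.ofFn_succ]
    rfl

lemma cost_ofFn (U : Fin n → ℝ) :
    (axisProblem Δ d γ h Q R V).cost x (List.ofFn U) =
      cost (Ad d γ h) (Bd d γ h) Q R V x U := by
  induction n generalizing x with
  | zero => simp [HorizonProblem.cost, cost, pred, axisProblem]
  | succ n ih =>
    rw [cost_succ, ← ih, List.ofFn_succ]
    rfl

lemma mem_plans_axisProblem_iff {us : List ℝ} : us ∈ (axisProblem Δ d γ h Q R V).plans n k x ↔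
    ∃ U : Fin n → ℝ, Feasible Δ d γ h k x U ∧ List.ofFn U = us := by
  constructor
  · rintro ⟨rfl, hus⟩
    exact ⟨us.get, by rwa [feasible_iff_isFeasible_ofFn, List.ofFn_get], List.ofFn_get us⟩
  · rintro ⟨U, hU, rfl⟩
    exact ⟨List.length_ofFn, feasible_iff_isFeasible_ofFn.1 hU⟩

lemma domain_axisProblem : (axisProblem Δ d γ h Q R V).domain = feasibleStates Δ d γ h := by
  ext n k x
  constructor
  · rintro ⟨us, hus⟩
    exact (mem_plans_axisProblem_iff.1 hus).imp fun _ h => h.1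
  · rintro ⟨U, hU⟩
    exact ⟨_, mem_plans_axisProblem_iff.2 ⟨U, hU, rfl⟩⟩

lemma IsMPCLaw.isRecedingHorizonLaw {hn : 0 < n + 1} {law : ℕ → State → ℝ}
    (hlaw : IsMPCLaw Δ d γ h Q R V (n + 1) hn law) :
    (axisProblem Δ d γ h Q R V).IsRecedingHorizonLaw (n + 1) law := by
  intro k x hx
  rw [domain_axisProblem] at hx
  obtain ⟨U, hU, hfirst⟩ := hlaw k x hx
  have hplan : law k x :: List.ofFn (Fin.tail U) = List.ofFn U := by
    rw [hfirst, List.ofFn_succ]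
    rfl
  refine ⟨List.ofFn (Fin.tail U), ?_, ?_⟩
  · exact mem_plans_axisProblem_iff.2 ⟨U, hU.1, hplan.symm⟩
  · intro us hus
    obtain ⟨U', hU', rfl⟩ := mem_plans_axisProblem_iff.1 hus
    rw [Set.mem_ofPred_eq, hplan, cost_ofFn, cost_ofFn]
    exact hU.2 U' hU'

lemma isTerminal_box (hh : 0 < h) (hγ : 0 < γ) (hΔ : ∀ t, 0 ≤ t → 0 ≤ Δ t)
    (hgrowth : ∀ k, (alpha h γ + beta h γ) * boundAt Δ h 0 k ≤ boundAt Δ h 0 (k + 1))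
    (hdescent : ∀ x, ∃ u, |u| ≤ deltaStar Δ h γ ∧
      V (step (Ad d γ h) (Bd d γ h) x u) + (quad Q x + u * R * u) ≤ V x) :
    (axisProblem Δ d γ h Q R V).IsTerminal (box (boundAt Δ h 0)) where
  next_mem hu := step_mem_box hh hγ hu
  exists_descent {_ x} hx := by
    obtain ⟨u, hu, hle⟩ := hdescent x
    exact ⟨u, mem_Icc_of_abs_le_deltaStar hh hγ hΔ hgrowth hx hu, (add_comm _ _).trans_le hle⟩

lemma stage_add_terminal_le {A : Matrix (Fin 4) (Fin 4) ℝ} {B : Matrix (Fin 4) (Fin 1) ℝ}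
    (hQ : Q.IsHermitian) (hR : 0 ≤ R) {a b : ℝ} (ha : 0 ≤ a) (hb : 0 ≤ b)
    (hV : ∀ x, V x ≤ a * eucl x ^ 2 + b * eucl x ^ 3) {C u : ℝ} (hu : |u| ≤ C * eucl x) :
    quad Q x + u * R * u + V (step A B x u) ≤
      (lamMax Q + R * C ^ 2 + a * (sigmaMax A + sigmaMax B * C) ^ 2) * eucl x ^ 2 +
        b * (sigmaMax A + sigmaMax B * C) ^ 3 * eucl x ^ 3 := by
  have hstep : eucl (step A B x u) ≤ (sigmaMax A + sigmaMax B * C) * eucl x :=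
    calc eucl (step A B x u) ≤ sigmaMax A * eucl x + sigmaMax B * |u| := eucl_step_le A B x u
      _ ≤ sigmaMax A * eucl x + sigmaMax B * (C * eucl x) := by
          gcongr
          exact sigmaMax_nonneg B
      _ = (sigmaMax A + sigmaMax B * C) * eucl x := by ring
  have huu : u ^ 2 ≤ (C * eucl x) ^ 2 := sq_le_sq' (neg_le_of_abs_le hu) (le_of_abs_le hu)
  have hnonneg := eucl_nonneg (step A B x u)
  calc quad Q x + u * R * u + V (step A B x u)
      ≤ lamMax Q * eucl x ^ 2 + R * u ^ 2 +
          (a * eucl (step A B x u) ^ 2 + b * eucl (step A B x u) ^ 3) := by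
        linarith [quad_le_lamMax hQ x, hV (step A B x u)]
    _ ≤ lamMax Q * eucl x ^ 2 + R * (C * eucl x) ^ 2 +
          (a * ((sigmaMax A + sigmaMax B * C) * eucl x) ^ 2 +
            b * ((sigmaMax A + sigmaMax B * C) * eucl x) ^ 3) := by gcongr
    _ = _ := by ring

theorem IsMPCLaw.ugas (hh : 0 < h) (hγ : 0 < γ) (hΔ : ∀ t, 0 ≤ t → 0 ≤ Δ t) (hQ : Q.PosDef)
    (hR : 0 ≤ R) (hV : ∀ x, 0 ≤ V x) {a b : ℝ} (ha : 0 ≤ a) (hb : 0 ≤ b)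
    (hVle : ∀ x, V x ≤ a * eucl x ^ 2 + b * eucl x ^ 3)
    (hbox : (axisProblem Δ d γ h Q R V).IsTerminal (box (boundAt Δ h 0)))
    {N : ℕ} {hN : 0 < N} {law : ℕ → State → ℝ} (hlaw : IsMPCLaw Δ d γ h Q R V N hN law) :
    UGAS (feasibleStates Δ d γ h N) fun k x => step (Ad d γ h) (Bd d γ h) x (law k x) := by
  obtain ⟨n, rfl⟩ := Nat.exists_eq_add_one.2 hN
  have huRu : ∀ u, 0 ≤ u * R * u := fun u => by nlinarith [mul_self_nonneg u]
  set C := (1 - alpha h γ - beta h γ)⁻¹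
  have hC : 0 ≤ C := inv_nonneg.2 (by linarith [alpha_add_beta_lt_one hh hγ])
  set L := sigmaMax (Ad d γ h) + sigmaMax (Bd d γ h) * C
  have hL : 0 ≤ L := add_nonneg (sigmaMax_nonneg _) (mul_nonneg (sigmaMax_nonneg _) hC)
  have hlamQ : 0 < lamMax Q := lamMax_pos hQ
  have hφ := IsClassKInfty.mul_pow (lamMin_pos hQ) two_ne_zero
  have hψ := (IsClassKInfty.mul_pow (n := 2) (a := lamMax Q + R * C ^ 2 + a * L ^ 2)
    (by positivity) two_ne_zero).add_mul_pow (b := b * L ^ 3) (by positivity) three_ne_zero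
  rw [← domain_axisProblem (Q := Q) (R := R) (V := V)]
  refine hlaw.isRecedingHorizonLaw.ugas hbox
    (zero_mem_box (boundAt_nonneg hh.le hΔ 0)) hφ hψ ?_ hV ?_
  · exact fun x u => (lamMin_le_quad hQ.isHermitian x).trans (le_add_of_nonneg_right (huRu u))
  · intro k x hne
    obtain ⟨u, hu, hux⟩ := exists_mem_Icc_abs_le_mul_eucl hh hγ hΔ hne
    exact ⟨u, hu, stage_add_terminal_le hQ.isHermitian hR ha hb hVle hux⟩

end AxisProblem

section TerminalCost

variable {Mc Mq : Matrix (Fin 4) (Fin 4) ℝ} {lam Θ : ℝ}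

lemma continuous_quad (M : Matrix (Fin 4) (Fin 4) ℝ) : Continuous (quad M) := by
  unfold quad
  fun_prop

lemma continuous_termCost (Mc Mq : Matrix (Fin 4) (Fin 4) ℝ) (lam Θ : ℝ) :
    Continuous (termCost Mc Mq lam Θ) := by
  have hpow : Continuous fun x => quad Mc x ^ (3 / 2 : ℝ) :=
    (continuous_quad Mc).rpow_const fun _ => Or.inr (by norm_num)
  exact continuous_const.mul ((continuous_quad Mq).add (continuous_const.mul hpow))

lemma termCost_nonneg (hMc : Mc.PosSemidef) (hMq : Mq.PosSemidef) (hlam : 0 ≤ lam) (hΘ : 0 ≤ Θ)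
    (x : State) : 0 ≤ termCost Mc Mq lam Θ x :=
  mul_nonneg hΘ (add_nonneg (quad_nonneg hMq x)
    (mul_nonneg hlam (Real.rpow_nonneg (quad_nonneg hMc x) _)))

lemma rpow_quad_le (hMc : Mc.PosDef) (x : State) :
    quad Mc x ^ (3 / 2 : ℝ) ≤ lamMax Mc ^ (3 / 2 : ℝ) * eucl x ^ 3 :=
  calc quad Mc x ^ (3 / 2 : ℝ) ≤ (lamMax Mc * eucl x ^ 2) ^ (3 / 2 : ℝ) :=
        Real.rpow_le_rpow (quad_nonneg hMc.posSemidef x) (quad_le_lamMax hMc.isHermitian x)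
          (by norm_num)
    _ = lamMax Mc ^ (3 / 2 : ℝ) * eucl x ^ 3 := by
        rw [Real.mul_rpow (lamMax_pos hMc).le (sq_nonneg _),
          ← Real.rpow_natCast_mul (eucl_nonneg x), ← Real.rpow_natCast _ 3]
        norm_num

lemma termCost_le (hMc : Mc.PosDef) (hMq : Mq.IsHermitian) (hlam : 0 ≤ lam) (hΘ : 0 ≤ Θ)
    (x : State) : termCost Mc Mq lam Θ x ≤
      Θ * lamMax Mq * eucl x ^ 2 + Θ * lam * lamMax Mc ^ (3 / 2 : ℝ) * eucl x ^ 3 :=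
  calc termCost Mc Mq lam Θ x
      ≤ Θ * (lamMax Mq * eucl x ^ 2 + lam * (lamMax Mc ^ (3 / 2 : ℝ) * eucl x ^ 3)) := by
        rw [termCost]
        gcongr
        exacts [quad_le_lamMax hMq x, rpow_quad_le hMc x]
    _ = _ := by ring

end TerminalCost

section Minimizers

variable {Δ : ℝ → ℝ} {d γ h : ℝ} {V : State → ℝ} {N k : ℕ} {x : State}

lemma continuous_step (A : Matrix (Fin 4) (Fin 4) ℝ) (B : Matrix (Fin 4) (Fin 1) ℝ) :
    Continuous fun p : State × ℝ => step A B p.1 p.2 := by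
  unfold step
  fun_prop

lemma continuous_pred (A : Matrix (Fin 4) (Fin 4) ℝ) (B : Matrix (Fin 4) (Fin 1) ℝ) (x : State)
    (i : ℕ) : Continuous fun U : Fin N → ℝ => pred A B x U i := by
  induction i with
  | zero => exact continuous_const
  | succ i ih =>
    have hu : Continuous fun U : Fin N → ℝ => if hi : i < N then U ⟨i, hi⟩ else 0 := by
      split_ifs <;> fun_prop
    exact (continuous_step A B).comp (ih.prodMk hu)

lemma continuous_cost (A : Matrix (Fin 4) (Fin 4) ℝ) (B : Matrix (Fin 4) (Fin 1) ℝ)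
    (Q : Matrix (Fin 4) (Fin 4) ℝ) (R : ℝ) (hV : Continuous V) (x : State) :
    Continuous fun U : Fin N → ℝ => cost A B Q R V x U := by
  have hpred := continuous_pred (N := N) A B x
  have hquad := continuous_quad Q
  unfold cost
  fun_prop

lemma isClosed_setOf_feasible : IsClosed {U : Fin N → ℝ | Feasible Δ d γ h k x U} := by
  have hpred := continuous_pred (N := N) (Ad d γ h) (Bd d γ h) x
  have hmin : ∀ i : Fin N, Continuous fun U : Fin N → ℝ =>
      uMin Δ h γ i k (pred (Ad d γ h) (Bd d γ h) x U i) := by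
    unfold uMin
    fun_prop
  have hmax : ∀ i : Fin N, Continuous fun U : Fin N → ℝ =>
      uMax Δ h γ i k (pred (Ad d γ h) (Bd d γ h) x U i) := by
    unfold uMax
    fun_prop
  simp only [Feasible, Set.ofPred_forall]
  exact isClosed_iInter fun i => (isClosed_le (hmin i) (continuous_apply i)).inter
    (isClosed_le (continuous_apply i) (hmax i))

lemma isCompact_setOf_feasible : IsCompact {U : Fin N → ℝ | Feasible Δ d γ h k x U} := by
  refine (isCompact_Icc (a := fun i : Fin N => -boundAt Δ h i k)
    (b := fun i : Fin N => boundAt Δ h i k)).of_isClosed_subset isClosed_setOf_feasible ?_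
  exact fun U hU => ⟨fun i => (le_max_left _ _).trans (hU i).1,
    fun i => (hU i).2.trans (min_le_left _ _)⟩

lemma exists_isOptimal (Q : Matrix (Fin 4) (Fin 4) ℝ) (R : ℝ) (hV : Continuous V)
    (hx : x ∈ feasibleStates Δ d γ h N k) :
    ∃ U : Fin N → ℝ, IsOptimal Δ d γ h Q R V k x U := by
  obtain ⟨U, hU, hmin⟩ := isCompact_setOf_feasible.exists_isMinOn hx
    (continuous_cost (Ad d γ h) (Bd d γ h) Q R hV x).continuousOn
  exact ⟨U, hU, fun U' hU' => hmin hU'⟩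

lemma exists_isMPCLaw (Δ : ℝ → ℝ) (d γ h : ℝ) (Q : Matrix (Fin 4) (Fin 4) ℝ) (R : ℝ)
    (hV : Continuous V) (hN : 0 < N) : ∃ law, IsMPCLaw Δ d γ h Q R V N hN law := by
  classical
  refine ⟨fun k x => if hx : x ∈ feasibleStates Δ d γ h N k then
    (exists_isOptimal Q R hV hx).choose ⟨0, hN⟩ else 0, fun k x hx => ?_⟩
  exact ⟨_, (exists_isOptimal Q R hV hx).choose_spec, dif_pos hx⟩

end Minimizers

end AxisMPC

end

theorem theorem4
    -- drag, filter and sampling constants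
    (d γ h : ℝ) (hd : 0 < d) (hγ : 0 < γ) (hh : 0 < h)
    -- the time-varying acceleration bound
    (Δ : ℝ → ℝ) (hΔ : ∀ t, 0 ≤ t → 0 < Δ t)
    (hcond : ∀ k : ℕ, AxisMPC.boundAt Δ h 0 (k + 1) >
      Real.exp (-(h / γ)) * (1 + h / γ) * AxisMPC.boundAt Δ h 0 k)
    -- the stage cost
    (Q : Matrix (Fin 4) (Fin 4) ℝ) (hQ : Q.PosDef) (R : ℝ) (hR : 0 < R)
    -- the matrix `M_c`, the gain `κ`, and the matrix `M_q` belonging to `K = -κ B_dᵀ M_c A_d`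
    (Mc : Matrix (Fin 4) (Fin 4) ℝ) (hMc : Mc.PosDef)
    (hMcA : (Mc - (AxisMPC.Ad d γ h)ᵀ * Mc * AxisMPC.Ad d γ h).PosSemidef)
    (κ : ℝ) (hκ : 0 < κ)
    (hκB : (1 - κ • ((AxisMPC.Bd d γ h)ᵀ * Mc * AxisMPC.Bd d γ h)).PosDef)
    (K : Matrix (Fin 1) (Fin 4) ℝ)
    (hK : K = -(κ • ((AxisMPC.Bd d γ h)ᵀ * Mc * AxisMPC.Ad d γ h)))
    (Mq : Matrix (Fin 4) (Fin 4) ℝ) (hMq : Mq.PosDef)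
    (hMqA : (AxisMPC.Ad d γ h + AxisMPC.Bd d γ h * K)ᵀ * Mq *
      (AxisMPC.Ad d γ h + AxisMPC.Bd d γ h * K) - Mq = -1)
    -- the constants `L_u`, `λ` and `Θ`
    (Lu : ℝ) (hLu : 1 < AxisMPC.deltaStar Δ h γ * Lu)
    (lam : ℝ)
    (hlam : lam = 2 * κ * Lu * AxisMPC.sigmaMax ((AxisMPC.Ad d γ h)ᵀ * Mq * AxisMPC.Bd d γ h) /
      Real.sqrt (AxisMPC.lamMin Mc))
    (Θ : ℝ) (hΘ : 0 < Θ)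
    (hΘQ : AxisMPC.lamMax (Q + (κ ^ 2 * R) • ((AxisMPC.Ad d γ h)ᵀ * Mc * AxisMPC.Bd d γ h *
      (AxisMPC.Bd d γ h)ᵀ * Mc * AxisMPC.Ad d γ h)) ≤ Θ)
    -- the horizon
    (N : ℕ) (hN : 0 < N) :
    (∀ (k : ℕ) (x : AxisMPC.State),
        |x 2| ≤ AxisMPC.boundAt Δ h 0 k → |x 3| ≤ AxisMPC.boundAt Δ h 0 k →
        x ∈ AxisMPC.feasibleStates Δ d γ h N k) ∧
    (∃ kN : ℕ → AxisMPC.State → ℝ,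
        AxisMPC.IsMPCLaw Δ d γ h Q R (AxisMPC.termCost Mc Mq lam Θ) N hN kN) ∧
    (∀ kN : ℕ → AxisMPC.State → ℝ,
        AxisMPC.IsMPCLaw Δ d γ h Q R (AxisMPC.termCost Mc Mq lam Θ) N hN kN →
        AxisMPC.UGAS (AxisMPC.feasibleStates Δ d γ h N)
          (fun k x => AxisMPC.step (AxisMPC.Ad d γ h) (AxisMPC.Bd d γ h) x (kN k x))) := by
  have hΔ0 : ∀ t, 0 ≤ t → 0 ≤ Δ t := fun t ht => (hΔ t ht).le
  have hgrowth : ∀ k, (AxisMPC.alpha h γ + AxisMPC.beta h γ) * AxisMPC.boundAt Δ h 0 k ≤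
      AxisMPC.boundAt Δ h 0 (k + 1) := fun k => by
    rw [AxisMPC.alpha, AxisMPC.beta]
    linarith [hcond k]
  have hm := AxisMPC.deltaStar_nonneg hh hγ hΔ0 hgrowth
  have hLu0 : 0 < Lu := pos_of_mul_pos_right (one_pos.trans hLu) hm
  have hσ := AxisMPC.sigmaMax_nonneg ((AxisMPC.Ad d γ h)ᵀ * Mq * AxisMPC.Bd d γ h)
  have hlam0 : 0 ≤ lam := by
    rw [hlam]
    positivity
  have hMq0 := (AxisMPC.lamMax_pos hMq).le
  have hMc0 := (AxisMPC.lamMax_pos hMc).le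
  have hbox := AxisMPC.isTerminal_box hh hγ hΔ0 hgrowth
    (AxisMPC.exists_termCost_step_le hQ.isHermitian hR.le hMc hMcA hκ hκB.posSemidef hK
      hMq.posSemidef hMqA hm hLu.le hlam hΘ.le hΘQ)
  refine ⟨fun k x h2 h3 => ?_, ?_, fun kN hkN => ?_⟩
  · rw [← AxisMPC.domain_axisProblem]
    exact hbox.subset_domain N k ⟨h2, h3⟩
  · exact AxisMPC.exists_isMPCLaw Δ d γ h Q R (AxisMPC.continuous_termCost Mc Mq lam Θ) hN
  · exact hkN.ugas hh hγ hΔ0 hQ hR.le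
      (AxisMPC.termCost_nonneg hMc.posSemidef hMq.posSemidef hlam0 hΘ.le) (by positivity)
      (by positivity) (AxisMPC.termCost_le hMc hMq.isHermitian hlam0 hΘ.le) hbox
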